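/- Let $(S,\mathfrak n)$ be a commutative noetherian local ring and let $\omega\in\mathfrak n$ be a non-zerodivisor. Let $\mathcal P$ be the class of finitely generated projective $S$-modules and $\mathcal G$ the class of finitely generated Gorenstein projective $S$-modules, i.e. finitely generated $S$-modules $M$ such that $\mathrm{Ext}^i_S(M,S)=0=\mathrm{Ext}^i_S(\mathrm{Hom}_S(M,S),S)$ for all $i\ge 1$ and the biduality map $M\to \mathrm{Hom}_S(\mathrm{Hom}_S(M,S),S)$ is an isomorphism. For $\mathcal X\in\{\mathcal P,\mathcal G\}$ let $\mathsf{MF}(\omega,\mathcal X)$ be the category whose objects are pairs of $S$-homomorphisms $g_1:G_1\to G_0$, $g_0:G_0\to G_1$ with $G_1,G_0\in\mathcal X$, $g_0g_1=\omega\cdot\mathrm{id}_{G_1}$ and $g_1g_0=\omega\cdot\mathrm{id}_{G_0}$, and whose morphisms are pairs $(\phi_1,\phi_0)$ of $S$-homomorphisms commuting with $g_1$ and $g_0$; its conflations are the sequences that are short exact sequences of $S$-modules in both components. Then $\mathsf{MF}(\omega,\mathcal G)$ and $\mathsf{MF}(\omega,\mathcal P)$ are Frobenius categories (exact categories in the sense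 of Quillen, with enough projectives and enough injectives, in which projective and injective objects coincide), and $\mathsf{MF}(\omega,\mathcal P)$ is an admissible subcategory of $\mathsf{MF}(\omega,\mathcal G)$: it is a full extension-closed exact subcategory, and for each object $X$ of $\mathsf{MF}(\omega,\mathcal P)$ there are conflations $X\to Q\to X'$ and $X''\to P\to X$ in $\mathsf{MF}(\omega,\mathcal P)$ such that $P$ and $Q$ are projective objects of $\mathsf{MF}(\omega,\mathcal G)$. The two categories have the same projective objects: an object of $\mathsf{MF}(\omega,\mathcal P)$ is projective in $\mathsf{MF}(\omega,\mathcal P)$ if and only if it is projective in $\mathsf{MF}(\omega,\mathcal G)$, and every projective object of $\mathsf{MF}(\omega,\mathcal G)$ belongs to $\mathsf{MF}(\omega,\mathcal P)$. Consequently the inclusion $\mathsf{MF}(\omega,\mathcal P)\to\mathsf{MF}(\omega,\mathcal G)$ induces a fully faithful triangle functor $\underline{\mathsf{MF}}(\omega,\mathcal P)\to\underline{\mathsf{MF}}(\omega,\mathcal G)$. Here the stable category $\underline{\mathcal F}$ of a Frobenius category $\mathcal F$ has the objects of $\mathcal F$ and the morphisms of $\mathcal F$ modulo those factoring through a projective object;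 its suspension $\Sigma$ is given by chosen conflations $X\to I(X)\to\Sigma X$ with $I(X)$ injective; its distinguished triangles are those isomorphic in $\underline{\mathcal F}$ to a standard triangle $A\xrightarrow{f}B\xrightarrow{g}D\xrightarrow{h}\Sigma A$, where $f,g,h$ are morphisms of $\mathcal F$, $B\xrightarrow{g}D\xrightarrow{h}\Sigma A$ is a conflation, and some morphism $I(A)\to D$ together with $f$ and $\mathrm{id}_{\Sigma A}$ is a morphism from the conflation $A\to I(A)\to\Sigma A$ to it. A triangle functor is an additive functor $F$ with a natural isomorphism $F\Sigma\cong\Sigma F$ through which it carries distinguished triangles to distinguished triangles. -/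

import Mathlib

open CategoryTheory CategoryTheory.Limits

universe v v' u u'

/-! ## Exact categories, Frobenius categories and admissible subcategories -/

namespace ExactCat

section Basic

variable {C : Type u} [Category.{v} C] [Preadditive C]

/-- `i` is an admissible monic (inflation) for the class `E` of conflations. -/
def Inflation (E : ObjectProperty (ShortComplex C)) {X Y : C} (i : X ⟶ Y) : Prop :=
  ∃ (Z : C) (p : Y ⟶ Z) (w : i ≫ p = 0), E (ShortComplex.mk i p w)

/-- `p` is an admissible epic (deflation) for the class `E` of conflations. -/
def Deflation (E : ObjectProperty (ShortComplex C)) {Y Z : C} (p : Y ⟶ Z) : Prop :=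
  ∃ (X : C) (i : X ⟶ Y) (w : i ≫ p = 0), E (ShortComplex.mk i p w)

/-- `(C, E)` is an exact category in the sense of Quillen: `C` is additive, and `E` is a class of
kernel-cokernel pairs, closed under isomorphisms, subject to the usual axioms. -/
class IsExact (E : ObjectProperty (ShortComplex C)) : Prop where
  hasFiniteBiproducts : HasFiniteBiproducts C
  isClosedUnderIsomorphisms : E.IsClosedUnderIsomorphisms
  kernel : ∀ T : ShortComplex C, E T → Nonempty (IsLimit (KernelFork.ofι T.f T.zero))
  cokernel : ∀ T : ShortComplex C, E T → Nonempty (IsColimit (CokernelCofork.ofπ T.g T.zero))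
  inflation_id : ∀ X : C, Inflation E (𝟙 X)
  deflation_id : ∀ X : C, Deflation E (𝟙 X)
  inflation_comp : ∀ {X Y Z : C} (i : X ⟶ Y) (j : Y ⟶ Z),
    Inflation E i → Inflation E j → Inflation E (i ≫ j)
  deflation_comp : ∀ {X Y Z : C} (p : X ⟶ Y) (q : Y ⟶ Z),
    Deflation E p → Deflation E q → Deflation E (p ≫ q)
  pushout : ∀ {X Y X' : C} (i : X ⟶ Y) (f : X ⟶ X'), Inflation E i →
    ∃ (Y' : C) (f' : Y ⟶ Y') (i' : X' ⟶ Y'), IsPushout i f f' i' ∧ Inflation E i'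
  pullback : ∀ {Y Z Z' : C} (p : Y ⟶ Z) (f : Z' ⟶ Z), Deflation E p →
    ∃ (Y' : C) (f' : Y' ⟶ Y) (p' : Y' ⟶ Z'), IsPullback f' p' p f ∧ Deflation E p'

/-- Projective objects of an exact category (lifting along deflations). -/
def IsProj (E : ObjectProperty (ShortComplex C)) (P : C) : Prop :=
  ∀ {Y Z : C} (p : Y ⟶ Z), Deflation E p → ∀ f : P ⟶ Z, ∃ g : P ⟶ Y, g ≫ p = f

/-- Injective objects of an exact category (extension along inflations). -/
def IsInj (E : ObjectProperty (ShortComplex C)) (I : C) : Prop :=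
  ∀ {X Y : C} (i : X ⟶ Y), Inflation E i → ∀ f : X ⟶ I, ∃ g : Y ⟶ I, i ≫ g = f

/-- `(C, E)` is a Frobenius category. -/
class IsFrobenius (E : ObjectProperty (ShortComplex C)) : Prop extends IsExact E where
  enoughProj : ∀ X : C, ∃ (P : C) (p : P ⟶ X), IsProj E P ∧ Deflation E p
  enoughInj : ∀ X : C, ∃ (I : C) (i : X ⟶ I), IsInj E I ∧ Inflation E i
  proj_iff_inj : ∀ X : C, IsProj E X ↔ IsInj E X

/-- The fully faithful additive functor `i : D ⥤ C` exhibits `(D, E')` as an admissible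
subcategory of the Frobenius category `(C, E)`: it is an extension-closed exact subcategory, and
each `X` in `D` has conflations `X ⟶ Q ⟶ X'` and `X'' ⟶ P ⟶ X` in `D` whose middle terms are
projective in `C`. -/
structure IsAdmissibleSubcategory {D : Type u'} [Category.{v'} D] [Preadditive D]
    (E : ObjectProperty (ShortComplex C)) (E' : ObjectProperty (ShortComplex D))
    (i : D ⥤ C) [i.Additive] : Prop where
  frobenius : IsFrobenius E
  full : i.Full
  faithful : i.Faithful
  exact : IsExact E'
  /-- The conflations of `D` are the conflations of `C` with all terms in `D`. -/
  conflation_iff : ∀ T : ShortComplex D, E' T ↔ E (T.map i)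
  extension_closed : ∀ T : ShortComplex C, E T →
    i.essImage T.X₁ → i.essImage T.X₃ → i.essImage T.X₂
  exists_to_proj : ∀ X : D, ∃ (Q X' : D) (a : X ⟶ Q) (b : Q ⟶ X') (w : a ≫ b = 0),
    E' (ShortComplex.mk a b w) ∧ IsProj E (i.obj Q)
  exists_from_proj : ∀ X : D, ∃ (P X'' : D) (a : X'' ⟶ P) (b : P ⟶ X) (w : a ≫ b = 0),
    E' (ShortComplex.mk a b w) ∧ IsProj E (i.obj P)

/-! ## The stable category -/

/-- Two morphisms are identified when their difference factors through a projective object. -/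
def stableRel (E : ObjectProperty (ShortComplex C)) : HomRel C := fun X Y f g =>
  ∃ (P : C) (a : X ⟶ P) (b : P ⟶ Y), IsProj E P ∧ f - g = a ≫ b

/-- The stable category: objects of `C`, morphisms modulo those factoring through a projective. -/
abbrev Stable (E : ObjectProperty (ShortComplex C)) := CategoryTheory.Quotient (stableRel E)

/-- The canonical functor to the stable category. -/
abbrev toStable (E : ObjectProperty (ShortComplex C)) : C ⥤ Stable E :=
  CategoryTheory.Quotient.functor (stableRel E)

lemma IsProj.biprod (E : ObjectProperty (ShortComplex C)) [HasBinaryBiproducts C] {P Q : C} (hP : IsProj E P) (hQ : IsProj E Q) :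
    IsProj E (P ⊞ Q) := by
  intro Y Z p hp f
  obtain ⟨a, ha⟩ := hP p hp (biprod.inl ≫ f)
  obtain ⟨b, hb⟩ := hQ p hp (biprod.inr ≫ f)
  exact ⟨biprod.desc a b, by ext <;> simp [ha, hb]⟩

variable (E : ObjectProperty (ShortComplex C)) [hE : IsFrobenius E]

lemma stableRel_add ⦃X Y : C⦄ (f₁ f₂ g₁ g₂ : X ⟶ Y) (hf : stableRel E f₁ f₂)
    (hg : stableRel E g₁ g₂) : stableRel E (f₁ + g₁) (f₂ + g₂) := by
  have := hE.hasFiniteBiproducts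
  have : HasBinaryBiproducts C := hasBinaryBiproducts_of_finite_biproducts C
  obtain ⟨P, a, b, hP, h⟩ := hf
  obtain ⟨Q, c, d, hQ, h'⟩ := hg
  refine ⟨P ⊞ Q, biprod.lift a c, biprod.desc b d, IsProj.biprod E hP hQ, ?_⟩
  rw [biprod.lift_desc, ← h, ← h']
  abel

instance : Congruence (stableRel E) where
  equivalence {X Y} :=
    { refl := fun f => by
        obtain ⟨P, p, hP, -⟩ := hE.enoughProj Y
        exact ⟨P, 0, p, hP, by simp⟩
      symm := by
        rintro f g ⟨P, a, b, hP, h⟩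
        exact ⟨P, -a, b, hP, by rw [Preadditive.neg_comp, ← h]; abel⟩
      trans := by
        rintro f g k h₁ h₂
        obtain ⟨P, a, b, hP, h⟩ := stableRel_add E _ _ _ _ h₁ h₂
        exact ⟨P, a, b, hP, by rw [← h]; abel⟩ }
  comp_left := by
    rintro X Y Z f g g' ⟨P, a, b, hP, h⟩
    exact ⟨P, f ≫ a, b, hP, by rw [← Preadditive.comp_sub, h, Category.assoc]⟩
  comp_right := by
    rintro X Y Z f f' g ⟨P, a, b, hP, h⟩
    exact ⟨P, a, b ≫ g, hP, by rw [← Preadditive.sub_comp, h, Category.assoc]⟩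

instance : Preadditive (Stable E) :=
  CategoryTheory.Quotient.preadditive (stableRel E) (stableRel_add E)

/-! ## The suspension functor

For each `X` a conflation `X ⟶ I X ⟶ Σ X` with `I X` injective is fixed; the suspension of the
stable category sends `X` to `Σ X`. -/

/-- The chosen injective object containing `X`. -/
noncomputable def hull (X : C) : C := (hE.enoughInj X).choose

/-- The chosen inflation `X ⟶ I X`. -/
noncomputable def hullι (X : C) : X ⟶ hull E X := (hE.enoughInj X).choose_spec.choose

lemma isInj_hull (X : C) : IsInj E (hull E X) := (hE.enoughInj X).choose_spec.choose_spec.1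

lemma inflation_hullι (X : C) : Inflation E (hullι E X) :=
  (hE.enoughInj X).choose_spec.choose_spec.2

/-- The cokernel `Σ X` of `X ⟶ I X`. -/
noncomputable def cosyzygy (X : C) : C := (inflation_hullι E X).choose

/-- The deflation `I X ⟶ Σ X`. -/
noncomputable def hullπ (X : C) : hull E X ⟶ cosyzygy E X :=
  (inflation_hullι E X).choose_spec.choose

lemma hull_zero (X : C) : hullι E X ≫ hullπ E X = 0 :=
  (inflation_hullι E X).choose_spec.choose_spec.choose

lemma hull_conflation (X : C) : E (ShortComplex.mk (hullι E X) (hullπ E X) (hull_zero E X)) :=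
  (inflation_hullι E X).choose_spec.choose_spec.choose_spec

lemma exists_hull_desc {X Z : C} (s : hull E X ⟶ Z) (hs : hullι E X ≫ s = 0) :
    ∃ t : cosyzygy E X ⟶ Z, hullπ E X ≫ t = s := by
  obtain ⟨hc⟩ := hE.cokernel _ (hull_conflation E X)
  exact ⟨hc.desc (CokernelCofork.ofπ s hs), hc.fac _ WalkingParallelPair.one⟩

lemma hullπ_cancel {X Z : C} (s t : cosyzygy E X ⟶ Z) (h : hullπ E X ≫ s = hullπ E X ≫ t) :
    s = t := by
  obtain ⟨hc⟩ := hE.cokernel _ (hull_conflation E X)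
  exact Cofork.IsColimit.hom_ext hc h

/-- A morphism `h : Σ X ⟶ Σ Y` lies over `f : X ⟶ Y` when some `a : I X ⟶ I Y` makes the ladder
between the chosen conflations commute. -/
def LiesOver {X Y : C} (f : X ⟶ Y) (h : cosyzygy E X ⟶ cosyzygy E Y) : Prop :=
  ∃ a : hull E X ⟶ hull E Y, hullι E X ≫ a = f ≫ hullι E Y ∧ hullπ E X ≫ h = a ≫ hullπ E Y

lemma exists_liesOver {X Y : C} (f : X ⟶ Y) : ∃ h, LiesOver E f h := by
  obtain ⟨a, ha⟩ := isInj_hull E Y (hullι E X) (inflation_hullι E X) (f ≫ hullι E Y)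
  obtain ⟨h, hh⟩ := exists_hull_desc E (a ≫ hullπ E Y)
    (by rw [← Category.assoc, ha, Category.assoc, hull_zero, comp_zero])
  exact ⟨h, a, ha, hh⟩

/-- A chosen morphism `Σ X ⟶ Σ Y` over `f`; it is unique up to morphisms factoring through
projectives. -/
noncomputable def cosyzygyMap {X Y : C} (f : X ⟶ Y) : cosyzygy E X ⟶ cosyzygy E Y :=
  (exists_liesOver E f).choose

lemma cosyzygyMap_liesOver {X Y : C} (f : X ⟶ Y) : LiesOver E f (cosyzygyMap E f) :=
  (exists_liesOver E f).choose_spec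

lemma LiesOver.stableRel {X Y : C} {f f' : X ⟶ Y} {h h' : cosyzygy E X ⟶ cosyzygy E Y}
    (hf : LiesOver E f h) (hf' : LiesOver E f' h') (hr : stableRel E f f') :
    stableRel E h h' := by
  obtain ⟨a, ha, hh⟩ := hf
  obtain ⟨a', ha', hh'⟩ := hf'
  obtain ⟨P, b, c, hP, hbc⟩ := hr
  obtain ⟨d, hd⟩ := (hE.proj_iff_inj P).1 hP (hullι E X) (inflation_hullι E X) b
  obtain ⟨s, hs⟩ := exists_hull_desc E (a - a' - d ≫ c ≫ hullι E Y) (by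
    rw [Preadditive.comp_sub, Preadditive.comp_sub, ha, ha', ← Category.assoc, hd,
      ← Preadditive.sub_comp, hbc, Category.assoc, sub_self])
  refine ⟨hull E Y, s, hullπ E Y, (hE.proj_iff_inj _).2 (isInj_hull E Y), ?_⟩
  apply hullπ_cancel
  rw [Preadditive.comp_sub, hh, hh', ← Category.assoc, hs, Preadditive.sub_comp,
    Preadditive.sub_comp]
  simp only [Category.assoc, hull_zero, comp_zero, sub_zero]

lemma LiesOver.id (X : C) : LiesOver E (𝟙 X) (𝟙 _) := ⟨𝟙 _, by simp, by simp⟩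

lemma LiesOver.comp {X Y Z : C} {f : X ⟶ Y} {g : Y ⟶ Z} {h k}
    (hf : LiesOver E f h) (hg : LiesOver E g k) : LiesOver E (f ≫ g) (h ≫ k) := by
  obtain ⟨a, ha, hh⟩ := hf
  obtain ⟨b, hb, hk⟩ := hg
  refine ⟨a ≫ b, ?_, ?_⟩
  · rw [← Category.assoc, ha, Category.assoc, hb, Category.assoc]
  · rw [← Category.assoc, hh, Category.assoc, hk, Category.assoc]

/-- The suspension functor `Σ` of the stable category of a Frobenius category. -/
noncomputable def suspension : Stable E ⥤ Stable E :=
  CategoryTheory.Quotient.lift (stableRel E)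
    { obj := fun X => (toStable E).obj (cosyzygy E X)
      map := fun f => (toStable E).map (cosyzygyMap E f)
      map_id := fun X => by
        rw [← (toStable E).map_id]
        exact CategoryTheory.Quotient.sound _ (LiesOver.stableRel E (cosyzygyMap_liesOver E _)
          (LiesOver.id E X) (Congruence.equivalence.refl _))
      map_comp := fun f g => by
        rw [← (toStable E).map_comp]
        exact CategoryTheory.Quotient.sound _ (LiesOver.stableRel E (cosyzygyMap_liesOver E _)
          (LiesOver.comp E (cosyzygyMap_liesOver E f) (cosyzygyMap_liesOver E g))
          (Congruence.equivalence.refl _)) }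
    (fun _ _ _ _ hr => CategoryTheory.Quotient.sound _ (LiesOver.stableRel E
      (cosyzygyMap_liesOver E _) (cosyzygyMap_liesOver E _) hr))

/-! ## Distinguished triangles and triangle functors -/

/-- `A ⟶ B ⟶ D ⟶ Σ A` is the standard triangle of `f : A ⟶ B` in `C`: there is a commutative
ladder of conflations from `A ⟶ I A ⟶ Σ A` to `B ⟶ D ⟶ Σ A` with left end `f` and right end the
identity (that is, `D` is the pushout of `A ⟶ I A` along `f`). -/
def IsStandardTriangle {A B D : C} (f : A ⟶ B) (g : B ⟶ D) (h : D ⟶ cosyzygy E A) : Prop :=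
  ∃ (w : g ≫ h = 0) (t : hull E A ⟶ D), E (ShortComplex.mk g h w) ∧
    hullι E A ≫ t = f ≫ g ∧ t ≫ h = hullπ E A

/-- Distinguished triangles of the stable category: those isomorphic to (the image of) a standard
triangle. -/
def Distinguished {X Y Z : Stable E} (u : X ⟶ Y) (v : Y ⟶ Z) (w : Z ⟶ (suspension E).obj X) :
    Prop :=
  ∃ (A B D : C) (f : A ⟶ B) (g : B ⟶ D) (h : D ⟶ cosyzygy E A)
    (a : X ≅ (toStable E).obj A) (b : Y ≅ (toStable E).obj B) (c : Z ≅ (toStable E).obj D),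
    IsStandardTriangle E f g h ∧
    u ≫ b.hom = a.hom ≫ (toStable E).map f ∧
    v ≫ c.hom = b.hom ≫ (toStable E).map g ∧
    w ≫ (suspension E).map a.hom = c.hom ≫ (toStable E).map h

/-- A triangle functor between stable categories: an additive functor `F` with a natural
isomorphism `F Σ ≅ Σ F` that carries distinguished triangles to distinguished triangles. -/
structure IsTriangleFunctor {D : Type u'} [Category.{v'} D] [Preadditive D]
    (E' : ObjectProperty (ShortComplex D)) [IsFrobenius E'] (F : Stable E' ⥤ Stable E) : Prop where
  additive : F.Additive
  exists_iso : ∃ α : suspension E' ⋙ F ≅ F ⋙ suspension E,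
    ∀ {X Y Z : Stable E'} (p : X ⟶ Y) (q : Y ⟶ Z) (r : Z ⟶ (suspension E').obj X),
      Distinguished E' p q r → Distinguished E (F.map p) (F.map q) (F.map r ≫ α.hom.app X)

end Basic

end ExactCat

/-! ## Matrix factorizations -/

/-- A matrix factorization of `ω` by `S`-modules: `d₁ : X₁ ⟶ X₀` and `d₀ : X₀ ⟶ X₁` whose
composites are multiplication by `ω`. -/
structure MatFact (S : Type u) [CommRing S] (ω : S) where
  X₁ : ModuleCat.{u} S
  X₀ : ModuleCat.{u} S
  d₁ : X₁ ⟶ X₀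
  d₀ : X₀ ⟶ X₁
  d₁_d₀ : d₁ ≫ d₀ = ω • 𝟙 X₁
  d₀_d₁ : d₀ ≫ d₁ = ω • 𝟙 X₀

namespace MatFact

variable {S : Type u} [CommRing S] {ω : S}

/-- Morphisms of matrix factorizations. -/
@[ext]
structure Hom (X Y : MatFact S ω) where
  f₁ : X.X₁ ⟶ Y.X₁
  f₀ : X.X₀ ⟶ Y.X₀
  comm₁ : f₁ ≫ Y.d₁ = X.d₁ ≫ f₀
  comm₀ : f₀ ≫ Y.d₀ = X.d₀ ≫ f₁

instance : Category (MatFact S ω) where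
  Hom := Hom
  id X := { f₁ := 𝟙 _, f₀ := 𝟙 _, comm₁ := by simp, comm₀ := by simp }
  comp f g :=
    { f₁ := f.f₁ ≫ g.f₁
      f₀ := f.f₀ ≫ g.f₀
      comm₁ := by rw [Category.assoc, g.comm₁, ← Category.assoc, f.comm₁, Category.assoc]
      comm₀ := by rw [Category.assoc, g.comm₀, ← Category.assoc, f.comm₀, Category.assoc] }

@[ext]
lemma hom_ext {X Y : MatFact S ω} {f g : X ⟶ Y} (h₁ : f.f₁ = g.f₁) (h₀ : f.f₀ = g.f₀) : f = g :=
  Hom.ext h₁ h₀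

@[simp] lemma id_f₁ (X : MatFact S ω) : (𝟙 X : X ⟶ X).f₁ = 𝟙 X.X₁ := rfl
@[simp] lemma id_f₀ (X : MatFact S ω) : (𝟙 X : X ⟶ X).f₀ = 𝟙 X.X₀ := rfl
@[simp] lemma comp_f₁ {X Y Z : MatFact S ω} (f : X ⟶ Y) (g : Y ⟶ Z) :
    (f ≫ g).f₁ = f.f₁ ≫ g.f₁ := rfl
@[simp] lemma comp_f₀ {X Y Z : MatFact S ω} (f : X ⟶ Y) (g : Y ⟶ Z) :
    (f ≫ g).f₀ = f.f₀ ≫ g.f₀ := rfl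

section

variable {X Y : MatFact S ω}

instance : Zero (X ⟶ Y) where
  zero := { f₁ := 0, f₀ := 0, comm₁ := by simp, comm₀ := by simp }

instance : Add (X ⟶ Y) where
  add f g :=
    { f₁ := f.f₁ + g.f₁
      f₀ := f.f₀ + g.f₀
      comm₁ := by rw [Preadditive.add_comp, f.comm₁, g.comm₁, Preadditive.comp_add]
      comm₀ := by rw [Preadditive.add_comp, f.comm₀, g.comm₀, Preadditive.comp_add] }

instance : Neg (X ⟶ Y) where
  neg f :=
    { f₁ := -f.f₁
      f₀ := -f.f₀
      comm₁ := by rw [Preadditive.neg_comp, f.comm₁, Preadditive.comp_neg]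
      comm₀ := by rw [Preadditive.neg_comp, f.comm₀, Preadditive.comp_neg] }

@[simp] lemma zero_f₁ : (0 : X ⟶ Y).f₁ = 0 := rfl
@[simp] lemma zero_f₀ : (0 : X ⟶ Y).f₀ = 0 := rfl
@[simp] lemma add_f₁ (f g : X ⟶ Y) : (f + g).f₁ = f.f₁ + g.f₁ := rfl
@[simp] lemma add_f₀ (f g : X ⟶ Y) : (f + g).f₀ = f.f₀ + g.f₀ := rfl
@[simp] lemma neg_f₁ (f : X ⟶ Y) : (-f).f₁ = -f.f₁ := rfl
@[simp] lemma neg_f₀ (f : X ⟶ Y) : (-f).f₀ = -f.f₀ := rfl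

instance : AddCommGroup (X ⟶ Y) where
  add_assoc f g h := by ext1 <;> simp [add_assoc]
  zero_add f := by ext1 <;> simp
  add_zero f := by ext1 <;> simp
  add_comm f g := by ext1 <;> simp [add_comm]
  neg_add_cancel f := by ext1 <;> simp
  nsmul := nsmulRec
  zsmul := zsmulRec

end

instance : Preadditive (MatFact S ω) where
  add_comp X Y Z f g h := by ext1 <;> simp
  comp_add X Y Z f g h := by ext1 <;> simp

/-- The component functor `(X₁ ⇄ X₀) ↦ X₁`. -/
@[simps]
def ev₁ : MatFact S ω ⥤ ModuleCat.{u} S where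
  obj X := X.X₁
  map f := f.f₁

/-- The component functor `(X₁ ⇄ X₀) ↦ X₀`. -/
@[simps]
def ev₀ : MatFact S ω ⥤ ModuleCat.{u} S where
  obj X := X.X₀
  map f := f.f₀

instance : (ev₁ : MatFact S ω ⥤ _).Additive where
instance : (ev₀ : MatFact S ω ⥤ _).Additive where

end MatFact

/-! ## Finitely generated projective and Gorenstein projective modules -/

/-- Finitely generated projective modules. -/
def fgProj (S : Type u) [CommRing S] : ObjectProperty (ModuleCat.{u} S) := fun M =>
  Module.Finite S M ∧ Module.Projective S M

/-- Finitely generated Gorenstein projective modules: `Ext^i(M, S) = 0 = Ext^i(M^*, S)` for all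
`i ≥ 1`, and the biduality map `M ⟶ M^**` is an isomorphism. -/
structure fgGorProj (S : Type u) [CommRing S] (M : ModuleCat.{u} S) : Prop where
  finite : Module.Finite S M
  ext_eq_zero : ∀ i : ℕ, 1 ≤ i → Subsingleton (Abelian.Ext.{u} M (ModuleCat.of S S) i)
  ext_dual_eq_zero : ∀ i : ℕ, 1 ≤ i →
    Subsingleton (Abelian.Ext.{u} (ModuleCat.of S (Module.Dual S M)) (ModuleCat.of S S) i)
  biduality : Function.Bijective (Module.Dual.eval S M)

lemma fgProj_le_fgGorProj (S : Type u) [CommRing S] : fgProj S ≤ fgGorProj S := by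
  rintro M ⟨hfin, hproj⟩
  refine ⟨hfin, ?_, ?_, Module.bijective_dual_eval S M⟩
  · rintro (_ | i) hi
    · omega
    · have : Projective M := (IsProjective.iff_projective (R := S) M).1 hproj
      exact Abelian.Ext.subsingleton_of_projective M _ i
  · rintro (_ | i) hi
    · omega
    · have : Projective (ModuleCat.of S (Module.Dual S M)) :=
        (IsProjective.iff_projective (R := S) _).1 inferInstance
      exact Abelian.Ext.subsingleton_of_projective _ _ i

/-! ## The exact categories `MF(ω, 𝒫)` and `MF(ω, 𝒢)` -/

section MF

variable {S : Type u} [CommRing S]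

/-- Matrix factorizations both of whose modules satisfy `Q`. -/
def hasTerms (Q : ObjectProperty (ModuleCat.{u} S)) (ω : S) : ObjectProperty (MatFact S ω) :=
  fun X => Q X.X₁ ∧ Q X.X₀

/-- `MF(ω, Q)`: the category of matrix factorizations of `ω` by modules satisfying `Q`. -/
abbrev MF (Q : ObjectProperty (ModuleCat.{u} S)) (ω : S) := (hasTerms Q ω).FullSubcategory

/-- The short exact sequences of `MF(ω, Q)`: both rows of modules are short exact. -/
def MF.conflation (Q : ObjectProperty (ModuleCat.{u} S)) (ω : S) :
    ObjectProperty (ShortComplex (MF Q ω)) := fun T =>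
  (T.map ((hasTerms Q ω).ι ⋙ MatFact.ev₁)).ShortExact ∧
    (T.map ((hasTerms Q ω).ι ⋙ MatFact.ev₀)).ShortExact

lemma hasTerms_mono {Q Q' : ObjectProperty (ModuleCat.{u} S)} (h : Q ≤ Q') (ω : S) :
    hasTerms Q ω ≤ hasTerms Q' ω := fun _ hX => ⟨h _ hX.1, h _ hX.2⟩

/-- The inclusion functor `MF(ω, 𝒫) ⥤ MF(ω, 𝒢)`. -/
def MF.incl (ω : S) : MF (fgProj S) ω ⥤ MF (fgGorProj S) ω :=
  ObjectProperty.ιOfLE (hasTerms_mono (fgProj_le_fgGorProj S) ω)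

instance (ω : S) : (MF.incl ω).Additive where

end MF

/-! Both Frobenius structures come from one argument about a class `Q` of modules, with the closure
properties collected in `IsFrobeniusClass`: it contains the finitely generated projectives, is
closed under extensions and kernels of epimorphisms, maps into projectives extend along a
monomorphism with cokernel in `Q`, and every member is a quotient of a finitely generated projective
and embeds into one with cokernel in `Q`.

For such a `Q` the decisive objects are the contractible factorizations on projectives `F₁`, `F₀`. A
map from one to `X` amounts to a pair `F₁ ⟶ X₁`, `F₀ ⟶ X₀`, and a map from `X` into one to a pair
`X₀ ⟶ F₁`, `X₁ ⟶ F₀`. Lifting and extension problems thus become problems about modules, so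
contractible factorizations are both projective and injective. Covering or embedding the two
components of `X` gives a deflation from, and an inflation into, a contractible factorization.
Projective objects and injective objects are therefore both the retracts of contractible ones
(`MF.isFrobenius`).

Finitely generated projectives form such a class because the relevant sequences split. For
Gorenstein projectives, one dualizes short exact sequences, uses the long exact Ext sequences of a
sequence and of its dual, and compares the sequence with its bidual by the five lemma; the embedding
into a projective is the dual of a surjection onto the dual module.

The contractible factorizations involve projective modules only, so they are the same for both
classes, and every projective object for the larger class already lies in the smaller category.
Hence a morphism of the smaller category that factors through a projective of the larger one does so
inside the smaller one, which gives faithfulness on stable categories; fullness is inherited from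
the inclusion. The functor is triangulated because cosyzygies and standard triangles do not depend,
up to stable isomorphism, on the conflation with projective-injective middle term used to form them
(`stableRel_τ₃`, `exists_stable_iso_of_ladders`). -/

namespace ExactCat

/-! ### Pushouts of conflations and stable isomorphisms. -/

section General

variable {C : Type u} [Category.{v} C] [Preadditive C]

namespace IsExact

variable {E : ObjectProperty (ShortComplex C)} [hE : IsExact E]

include hE

lemma exists_desc {T : ShortComplex C} (hT : E T) {Z : C} (s : T.X₂ ⟶ Z) (hs : T.f ≫ s = 0) :
    ∃ t : T.X₃ ⟶ Z, T.g ≫ t = s := by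
  obtain ⟨hc⟩ := hE.cokernel T hT
  exact ⟨hc.desc (CokernelCofork.ofπ s hs), hc.fac _ WalkingParallelPair.one⟩

lemma exists_lift {T : ShortComplex C} (hT : E T) {Z : C} (s : Z ⟶ T.X₂) (hs : s ≫ T.g = 0) :
    ∃ t : Z ⟶ T.X₁, t ≫ T.f = s := by
  obtain ⟨hc⟩ := hE.kernel T hT
  exact ⟨hc.lift (KernelFork.ofι s hs), hc.fac _ WalkingParallelPair.zero⟩

lemma epi_of_conflation {T : ShortComplex C} (hT : E T) : Epi T.g :=
  ⟨fun _ _ h => by obtain ⟨hc⟩ := hE.cokernel T hT; exact Cofork.IsColimit.hom_ext hc h⟩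

lemma mono_of_conflation {T : ShortComplex C} (hT : E T) : Mono T.f :=
  ⟨fun _ _ h => by obtain ⟨hc⟩ := hE.kernel T hT; exact Fork.IsLimit.hom_ext hc h⟩

/-- The pushout of a conflation `A ⟶ I ⟶ Z` along `f : A ⟶ B` is a conflation `B ⟶ D ⟶ Z`. -/
lemma exists_pushout_conflation {A I Z B : C} {ι : A ⟶ I} {π : I ⟶ Z} {w : ι ≫ π = 0}
    (hT : E (ShortComplex.mk ι π w)) (f : A ⟶ B) :
    ∃ (D : C) (g : B ⟶ D) (t : I ⟶ D) (h : D ⟶ Z) (w' : g ≫ h = 0), IsPushout ι f t g ∧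
      E (ShortComplex.mk g h w') ∧ t ≫ h = π := by
  obtain ⟨D, t, g, sq, Z', q, wq, hq⟩ := hE.pushout ι f ⟨Z, π, w, hT⟩
  have := hE.isClosedUnderIsomorphisms
  have hepi : Epi π := epi_of_conflation hT
  have hepi' : Epi q := epi_of_conflation hq
  let h : D ⟶ Z := sq.desc π 0 (by rw [w, comp_zero])
  have hth : t ≫ h = π := sq.inl_desc _ _ _
  have hgh : g ≫ h = 0 := sq.inr_desc _ _ _
  -- The pushout axiom yields an inflation with some cokernel `q : D ⟶ Z'`. The universal properties
  -- of `π` and `q` give mutually inverse maps between `Z` and `Z'`, so `h` can replace `q`.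
  obtain ⟨k, hk⟩ := exists_desc hT (t ≫ q)
    (by dsimp; rw [← Category.assoc, sq.w, Category.assoc, wq, comp_zero])
  obtain ⟨l, hl⟩ := exists_desc hq h hgh
  dsimp at hk hl
  have hkq : h ≫ k = q := by
    apply sq.hom_ext
    · rw [← Category.assoc, hth, hk]
    · rw [← Category.assoc, hgh, zero_comp, wq]
  let e : Z' ≅ Z :=
    { hom := l
      inv := k
      hom_inv_id := by rw [← cancel_epi q, ← Category.assoc, hl, hkq, Category.comp_id]
      inv_hom_id := by
        rw [← cancel_epi π, ← Category.assoc, hk, Category.assoc, hl, hth, Category.comp_id] }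
  refine ⟨D, g, t, h, hgh, sq, ?_, hth⟩
  exact E.prop_of_iso (X := ShortComplex.mk g q wq) (ShortComplex.isoMk (Iso.refl _) (Iso.refl _) e
    (by simp) (by simpa [e] using hl.symm)) hq

/-- In a ladder of conflations whose right end is the identity, the left square is a pushout. -/
lemma isPushout_of_ladder {A I Z B D : C} {ι : A ⟶ I} {π : I ⟶ Z} {w : ι ≫ π = 0}
    (hT : E (ShortComplex.mk ι π w)) {f : A ⟶ B} {g : B ⟶ D} {h : D ⟶ Z} {w' : g ≫ h = 0}
    (hT' : E (ShortComplex.mk g h w')) {t : I ⟶ D} (hι : ι ≫ t = f ≫ g) (hπ : t ≫ h = π) :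
    IsPushout ι f t g := by
  have hepi : Epi π := epi_of_conflation hT
  -- The difference vanishes on `g`, so it factors through `h`; the factor is zero because it
  -- vanishes on the epimorphism `π = t ≫ h`.
  have huniq : ∀ {W : C} (d d' : D ⟶ W), t ≫ d = t ≫ d' → g ≫ d = g ≫ d' → d = d' := by
    intro W d d' h₁ h₂
    obtain ⟨e, he⟩ := exists_desc hT' (d - d') (by simp [h₂])
    have : e = 0 := by
      rw [← cancel_epi π, ← hπ, Category.assoc, comp_zero]
      dsimp at he
      rw [he]
      simp [h₁]
    rw [this, comp_zero] at he
    exact sub_eq_zero.1 he.symm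
  -- Push the lower conflation out along `x` to get `W ⟶ W' ⟶ Z`. The discrepancy between the two
  -- maps `I ⟶ W'` factors through `π` by some `e`, and `-e` splits this conflation. The resulting
  -- retraction `r` of `j` turns `x' : D ⟶ W'` into the desired map.
  have hex : ∀ {W : C} (y : I ⟶ W) (x : B ⟶ W), ι ≫ y = f ≫ x →
      ∃ d : D ⟶ W, t ≫ d = y ∧ g ≫ d = x := by
    intro W y x hxy
    obtain ⟨W', j, x', h'', wj, sq, hj, hh⟩ := exists_pushout_conflation hT' x
    have hmono : Mono j := mono_of_conflation hj
    obtain ⟨e, he⟩ := exists_desc hT (y ≫ j - t ≫ x') (by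
      dsimp
      rw [Preadditive.comp_sub, ← Category.assoc, ← Category.assoc, hxy, hι, Category.assoc,
        Category.assoc, sq.w, sub_self])
    dsimp at he
    have heh : e ≫ h'' = -𝟙 Z := by
      rw [← cancel_epi π, ← Category.assoc, he, Preadditive.sub_comp, Category.assoc, wj,
        Category.assoc, hh, hπ]
      simp
    obtain ⟨r, hr⟩ := exists_lift hj (𝟙 W' + h'' ≫ e) (by
      dsimp
      rw [Preadditive.add_comp, Category.assoc, heh]
      simp)
    dsimp at hr
    have hjr : j ≫ r = 𝟙 W := by
      rw [← cancel_mono j, Category.assoc, hr, Preadditive.comp_add, ← Category.assoc j, wj]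
      simp
    refine ⟨x' ≫ r, ?_, ?_⟩
    · rw [← cancel_mono j, Category.assoc, Category.assoc, hr, Preadditive.comp_add,
        ← Category.assoc x', hh, Preadditive.comp_add, ← Category.assoc t h, hπ, he]
      simp
    · rw [← Category.assoc, sq.w, Category.assoc, hjr, Category.comp_id]
  exact IsPushout.of_isColimit' ⟨hι⟩ (PushoutCocone.IsColimit.mk _
    (fun s => (hex s.inl s.inr s.condition).choose)
    (fun s => (hex s.inl s.inr s.condition).choose_spec.1)
    (fun s => (hex s.inl s.inr s.condition).choose_spec.2)
    (fun s m h₁ h₂ => huniq _ _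
      (h₁.trans (hex s.inl s.inr s.condition).choose_spec.1.symm)
      (h₂.trans (hex s.inl s.inr s.condition).choose_spec.2.symm)))

end IsExact

lemma IsProj.of_retract {E : ObjectProperty (ShortComplex C)} {X P : C} (s : X ⟶ P) (r : P ⟶ X)
    (h : s ≫ r = 𝟙 X) (hP : IsProj E P) : IsProj E X := by
  intro Y Z p hp f
  obtain ⟨g, hg⟩ := hP p hp (r ≫ f)
  exact ⟨s ≫ g, by rw [Category.assoc, hg, ← Category.assoc, h, Category.id_comp]⟩

lemma IsInj.of_retract {E : ObjectProperty (ShortComplex C)} {X P : C} (s : X ⟶ P) (r : P ⟶ X)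
    (h : s ≫ r = 𝟙 X) (hP : IsInj E P) : IsInj E X := by
  intro Y Z p hp f
  obtain ⟨g, hg⟩ := hP p hp (f ≫ s)
  exact ⟨g ≫ r, by rw [← Category.assoc, hg, Category.assoc, h, Category.comp_id]⟩

variable (E : ObjectProperty (ShortComplex C)) [hE : IsFrobenius E]

lemma toStable_map_eq_iff {X Y : C} (f g : X ⟶ Y) :
    (toStable E).map f = (toStable E).map g ↔ stableRel E f g :=
  CategoryTheory.Quotient.functor_map_eq_iff _ _ _

/-- The chosen conflation `X ⟶ I X ⟶ Σ X`. -/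
noncomputable abbrev hullComplex (X : C) : ShortComplex C :=
  ShortComplex.mk (hullι E X) (hullπ E X) (hull_zero E X)

variable {E}

lemma exists_map_of_isInj {T T' : ShortComplex C} (hT : E T) (hI : IsInj E T'.X₂)
    (f : T.X₁ ⟶ T'.X₁) : ∃ φ : T ⟶ T', φ.τ₁ = f := by
  obtain ⟨a, ha⟩ := hI T.f ⟨_, _, T.zero, hT⟩ (f ≫ T'.f)
  obtain ⟨b, hb⟩ := IsExact.exists_desc hT (a ≫ T'.g)
    (by rw [← Category.assoc, ha, Category.assoc, T'.zero, comp_zero])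
  exact ⟨{ τ₁ := f, τ₂ := a, τ₃ := b, comm₁₂ := ha.symm, comm₂₃ := hb.symm }, rfl⟩

/-- The difference of the middle maps vanishes on `T.f`, hence descends to `s : T.X₃ ⟶ T'.X₂`, and
the difference of the right-hand maps is `s ≫ T'.g`. All uniqueness of cosyzygies in the stable
category is deduced from this. -/
lemma stableRel_τ₃ {T T' : ShortComplex C} (hT : E T) (hI : IsProj E T'.X₂) (φ ψ : T ⟶ T')
    (h : φ.τ₁ = ψ.τ₁) : stableRel E φ.τ₃ ψ.τ₃ := by
  have : Epi T.g := IsExact.epi_of_conflation hT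
  obtain ⟨s, hs⟩ := IsExact.exists_desc hT (φ.τ₂ - ψ.τ₂)
    (by rw [Preadditive.comp_sub, ← φ.comm₁₂, ← ψ.comm₁₂, h, sub_self])
  refine ⟨_, s, T'.g, hI, ?_⟩
  rw [← cancel_epi T.g, ← Category.assoc, hs, Preadditive.comp_sub, Preadditive.sub_comp,
    φ.comm₂₃, ψ.comm₂₃]

/-- Two pushouts of conflations with the same left end along the same morphism are stably
isomorphic when the middle terms of the conflations are projective. -/
lemma exists_stable_iso_of_ladders {A B I Z D I' Z' D' : C} {ι : A ⟶ I} {π : I ⟶ Z}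
    {w : ι ≫ π = 0} (hT : E (ShortComplex.mk ι π w)) {ι' : A ⟶ I'} {π' : I' ⟶ Z'}
    {w' : ι' ≫ π' = 0} (hT' : E (ShortComplex.mk ι' π' w')) (hI : IsProj E I) (hI' : IsProj E I')
    {f : A ⟶ B} {g : B ⟶ D} {h : D ⟶ Z} {t : I ⟶ D} (sq : IsPushout ι f t g)
    (hgh : g ≫ h = 0) (hth : t ≫ h = π)
    {g' : B ⟶ D'} {h' : D' ⟶ Z'} {t' : I' ⟶ D'} (sq' : IsPushout ι' f t' g')
    (hgh' : g' ≫ h' = 0) (hth' : t' ≫ h' = π')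
    {a : I ⟶ I'} {c : Z ⟶ Z'} (ha : ι ≫ a = ι') (hc : π ≫ c = a ≫ π')
    {a' : I' ⟶ I} (ha' : ι' ≫ a' = ι) :
    ∃ e : (toStable E).obj D ≅ (toStable E).obj D',
      (toStable E).map g ≫ e.hom = (toStable E).map g' ∧
      (toStable E).map h ≫ (toStable E).map c = e.hom ≫ (toStable E).map h' := by
  let φ : D ⟶ D' := sq.desc (a ≫ t') g' (by rw [← Category.assoc, ha, sq'.w])
  let ψ : D' ⟶ D := sq'.desc (a' ≫ t) g (by rw [← Category.assoc, ha', sq.w])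
  have hφt : t ≫ φ = a ≫ t' := sq.inl_desc _ _ _
  have hφg : g ≫ φ = g' := sq.inr_desc _ _ _
  have hψt : t' ≫ ψ = a' ≫ t := sq'.inl_desc _ _ _
  have hψg : g' ≫ ψ = g := sq'.inr_desc _ _ _
  -- `φ` and `ψ` need not be inverse in `C`, but each composite fixes `B` and covers an endomorphism
  -- `b` of `I` fixing `A`. Writing `b - 𝟙 = π ≫ s`, such an endomorphism of the pushout differs
  -- from the identity by `h ≫ s ≫ t`, which factors through `I`.
  have aux : ∀ {I Z D : C} {ι : A ⟶ I} {π : I ⟶ Z} {w : ι ≫ π = 0}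
      (_ : E (ShortComplex.mk ι π w)) (_ : IsProj E I) {g : B ⟶ D} {h : D ⟶ Z} {t : I ⟶ D}
      (_ : IsPushout ι f t g) (_ : g ≫ h = 0) (_ : t ≫ h = π) (θ : D ⟶ D) (b : I ⟶ I)
      (_ : ι ≫ b = ι) (_ : g ≫ θ = g) (_ : t ≫ θ = b ≫ t),
      (toStable E).map θ = 𝟙 _ := by
    intro I Z D ι π w hT hI g h t sq hgh hth θ b hb hgθ htθ
    obtain ⟨s, hs⟩ := IsExact.exists_desc hT (b - 𝟙 I) (by simp [hb])
    dsimp at hs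
    rw [← (toStable E).map_id, toStable_map_eq_iff]
    refine ⟨I, h ≫ s, t, hI, ?_⟩
    apply sq.hom_ext
    · rw [← Category.assoc, ← Category.assoc, hth, hs, Preadditive.comp_sub, htθ,
        Preadditive.sub_comp]
      simp
    · rw [← Category.assoc, ← Category.assoc, hgh, Preadditive.comp_sub, hgθ]
      simp
  refine ⟨⟨(toStable E).map φ, (toStable E).map ψ, ?_, ?_⟩, ?_, ?_⟩
  · rw [← (toStable E).map_comp]
    exact aux hT hI sq hgh hth _ (a ≫ a') (by rw [← Category.assoc, ha, ha'])
      (by rw [← Category.assoc, hφg, hψg])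
      (by rw [← Category.assoc, hφt, Category.assoc, hψt, Category.assoc])
  · rw [← (toStable E).map_comp]
    exact aux hT' hI' sq' hgh' hth' _ (a' ≫ a) (by rw [← Category.assoc, ha', ha])
      (by rw [← Category.assoc, hψg, hφg])
      (by rw [← Category.assoc, hψt, Category.assoc, hφt, Category.assoc])
  · rw [← (toStable E).map_comp, hφg]
  · rw [← (toStable E).map_comp, ← (toStable E).map_comp]
    congr 1
    apply sq.hom_ext
    · rw [← Category.assoc, ← Category.assoc, hth, hφt, Category.assoc, hth', hc]
    · rw [← Category.assoc, ← Category.assoc, hgh, hφg, hgh', zero_comp]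

end General

/-- This diagram chase and the next are stated in an arbitrary category because the objects they are
applied to agree only after unfolding `stableLift` and `suspension`. -/
lemma ladder_comp {K : Type*} [Category* K] {Y Z B M M' : K} {q : Y ⟶ Z} {c : Z ⟶ M} {b : Y ⟶ B}
    {g : B ⟶ M} {e : M ⟶ M'} {g' : B ⟶ M'} (h : q ≫ c = b ≫ g) (he : g ≫ e = g') :
    q ≫ c ≫ e = b ≫ g' := by
  rw [← Category.assoc, h, Category.assoc, he]

lemma ladder_comp_shift {K : Type*} [Category* K] {Z X X' M M' A A' : K} {r : Z ⟶ X} {s : X ⟶ A}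
    {c : Z ⟶ M} {k : M ⟶ A} {β : A ⟶ A'} {α : X ⟶ X'} {σ : X' ⟶ A'} {e : M ⟶ M'} {h' : M' ⟶ A'}
    (h : r ≫ s = c ≫ k) (hn : s ≫ β = α ≫ σ) (he : k ≫ β = e ≫ h') :
    (r ≫ α) ≫ σ = (c ≫ e) ≫ h' := by
  rw [Category.assoc, ← hn, ← Category.assoc, h, Category.assoc, he, Category.assoc]

/-! ## The functor induced on stable categories -/

section Induced

variable {C : Type u} [Category.{v} C] [Preadditive C] {D : Type u'} [Category.{v'} D]
  [Preadditive D] (E : ObjectProperty (ShortComplex C)) [hE : IsFrobenius E]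
  (E' : ObjectProperty (ShortComplex D)) (i : D ⥤ C) [i.Additive]
  (hP : ∀ X, IsProj E' X → IsProj E (i.obj X))

/-- The functor of stable categories induced by an additive functor preserving projectives. -/
def stableLift : Stable E' ⥤ Stable E :=
  CategoryTheory.Quotient.lift _ (i ⋙ toStable E) (by
    rintro X Y f g ⟨P, a, b, h, hab⟩
    exact (toStable_map_eq_iff E _ _).2 ⟨_, i.map a, i.map b, hP _ h, by
      rw [← i.map_sub, hab, i.map_comp]⟩)

lemma stableLift_full [i.Full] : (stableLift E E' i hP).Full where
  map_surjective {X Y} f := by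
    obtain ⟨X⟩ := X
    obtain ⟨Y⟩ := Y
    obtain ⟨f, rfl⟩ := (toStable E).map_surjective (X := i.obj X) (Y := i.obj Y) f
    obtain ⟨f, rfl⟩ := i.map_surjective f
    exact ⟨(toStable E').map f, rfl⟩

variable [hE' : IsFrobenius E']

lemma stableLift_additive : (stableLift E E' i hP).Additive where
  map_add {X Y f g} := by
    obtain ⟨X⟩ := X
    obtain ⟨Y⟩ := Y
    obtain ⟨f, rfl⟩ := (toStable E').map_surjective f
    obtain ⟨g, rfl⟩ := (toStable E').map_surjective g
    change (toStable E).map (i.map (f + g)) = (toStable E).map (i.map f + i.map g)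
    rw [i.map_add]

/-- A factorization through a projective of `C` can be pulled back along `i` once that projective is
known to come from a projective of `D`. -/
lemma stableLift_faithful [i.Full] [i.Faithful]
    (hP' : ∀ P, IsProj E P → ∃ Q, IsProj E' Q ∧ Nonempty (i.obj Q ≅ P)) :
    (stableLift E E' i hP).Faithful where
  map_injective {X Y f g} h := by
    obtain ⟨X⟩ := X
    obtain ⟨Y⟩ := Y
    obtain ⟨f, rfl⟩ := (toStable E').map_surjective (X := X) (Y := Y) f
    obtain ⟨g, rfl⟩ := (toStable E').map_surjective (X := X) (Y := Y) g
    obtain ⟨P, a, b, hPP, hab⟩ := (toStable_map_eq_iff E (i.map f) (i.map g)).1 h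
    obtain ⟨Q, hQ, ⟨e⟩⟩ := hP' P hPP
    rw [toStable_map_eq_iff]
    refine ⟨Q, i.preimage (a ≫ e.inv), i.preimage (e.hom ≫ b), hQ, i.map_injective ?_⟩
    simp [hab]

variable (hconf : ∀ T, E' T → E (T.map i))

/-- The image of the chosen conflation `X ⟶ I X ⟶ Σ X` under a functor. -/
noncomputable abbrev mapHullComplex (X : D) : ShortComplex C :=
  ShortComplex.mk (i.map (hullι E' X)) (i.map (hullπ E' X))
    (by rw [← i.map_comp, hull_zero, i.map_zero])

include hconf in
lemma mapHullComplex_conflation (X : D) : E (mapHullComplex E' i X) :=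
  hconf _ (hull_conflation E' X)

include hP in
lemma isProj_map_hull (X : D) : IsProj E (i.obj (hull E' X)) :=
  hP _ ((hE'.proj_iff_inj _).2 (isInj_hull E' X))

/-- A comparison of the image of the chosen conflation with the chosen conflation. -/
noncomputable def hullComparison (X : D) : mapHullComplex E' i X ⟶ hullComplex E (i.obj X) :=
  (exists_map_of_isInj (T := mapHullComplex E' i X) (T' := hullComplex E (i.obj X))
    (mapHullComplex_conflation E E' i hconf X) (isInj_hull E _) (𝟙 (i.obj X))).choose

lemma hullComparison_τ₁ (X : D) : (hullComparison E E' i hconf X).τ₁ = 𝟙 (i.obj X) :=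
  (exists_map_of_isInj (T := mapHullComplex E' i X) (T' := hullComplex E (i.obj X))
    (mapHullComplex_conflation E E' i hconf X) (isInj_hull E _) (𝟙 (i.obj X))).choose_spec

/-- A comparison of the chosen conflation with the image of the chosen conflation. -/
noncomputable def hullComparisonInv (X : D) : hullComplex E (i.obj X) ⟶ mapHullComplex E' i X :=
  (exists_map_of_isInj (T := hullComplex E (i.obj X)) (T' := mapHullComplex E' i X)
    (hull_conflation E _) ((hE.proj_iff_inj _).1 (isProj_map_hull E E' i hP X))
    (𝟙 (i.obj X))).choose

lemma hullComparisonInv_τ₁ (X : D) : (hullComparisonInv E E' i hP X).τ₁ = 𝟙 (i.obj X) :=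
  (exists_map_of_isInj (T := hullComplex E (i.obj X)) (T' := mapHullComplex E' i X)
    (hull_conflation E _) ((hE.proj_iff_inj _).1 (isProj_map_hull E E' i hP X))
    (𝟙 (i.obj X))).choose_spec

/-- The isomorphism `i (Σ X) ≅ Σ (i X)` in the stable category. -/
noncomputable def cosyzygyIso (X : D) :
    (toStable E).obj (i.obj (cosyzygy E' X)) ≅ (toStable E).obj (cosyzygy E (i.obj X)) where
  hom := (toStable E).map (hullComparison E E' i hconf X).τ₃
  inv := (toStable E).map (hullComparisonInv E E' i hP X).τ₃
  hom_inv_id := by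
    -- The composite of the comparisons and the identity are maps of conflations with the same left
    -- end, so their right ends agree stably.
    rw [← (toStable E).map_comp, ← (toStable E).map_id, toStable_map_eq_iff]
    exact stableRel_τ₃ (mapHullComplex_conflation E E' i hconf X) (isProj_map_hull E E' i hP X)
      (hullComparison E E' i hconf X ≫ hullComparisonInv E E' i hP X) (𝟙 _)
      (by rw [ShortComplex.comp_τ₁, hullComparison_τ₁, hullComparisonInv_τ₁]
          exact Category.comp_id _)
  inv_hom_id := by
    rw [← (toStable E).map_comp, ← (toStable E).map_id, toStable_map_eq_iff]
    exact stableRel_τ₃ (hull_conflation E _) ((hE.proj_iff_inj _).2 (isInj_hull E _))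
      (hullComparisonInv E E' i hP X ≫ hullComparison E E' i hconf X) (𝟙 _)
      (by rw [ShortComplex.comp_τ₁, hullComparison_τ₁, hullComparisonInv_τ₁]
          exact Category.comp_id _)

/-- Both sides are right ends of maps from the image of the hull conflation of `X` to the hull
conflation of `i.obj Y`, with the same left end `i.map f`. -/
lemma cosyzygyIso_naturality {X Y : D} (f : X ⟶ Y) :
    (toStable E).map (i.map (cosyzygyMap E' f)) ≫ (cosyzygyIso E E' i hP hconf Y).hom =
      (cosyzygyIso E E' i hP hconf X).hom ≫ (toStable E).map (cosyzygyMap E (i.map f)) := by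
  obtain ⟨a, ha, hb⟩ := cosyzygyMap_liesOver E' f
  obtain ⟨a', ha', hb'⟩ := cosyzygyMap_liesOver E (i.map f)
  let φ : mapHullComplex E' i X ⟶ mapHullComplex E' i Y :=
    { τ₁ := i.map f, τ₂ := i.map a, τ₃ := i.map (cosyzygyMap E' f)
      comm₁₂ := by dsimp; rw [← i.map_comp, ← ha, i.map_comp]
      comm₂₃ := by dsimp; rw [← i.map_comp, ← hb, i.map_comp] }
  let φ' : hullComplex E (i.obj X) ⟶ hullComplex E (i.obj Y) :=
    { τ₁ := i.map f, τ₂ := a', τ₃ := cosyzygyMap E (i.map f), comm₁₂ := ha'.symm,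
      comm₂₃ := hb'.symm }
  dsimp only [cosyzygyIso]
  rw [← (toStable E).map_comp, ← (toStable E).map_comp, toStable_map_eq_iff]
  refine stableRel_τ₃ (mapHullComplex_conflation E E' i hconf X)
    ((hE.proj_iff_inj _).2 (isInj_hull E _)) (φ ≫ hullComparison E E' i hconf Y)
    (hullComparison E E' i hconf X ≫ φ') ?_
  rw [ShortComplex.comp_τ₁, ShortComplex.comp_τ₁, hullComparison_τ₁, hullComparison_τ₁]
  exact (Category.comp_id _).trans (Category.id_comp _).symm

/-- The natural isomorphism expressing that `stableLift` commutes with the suspension. -/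
noncomputable def suspensionIso :
    suspension E' ⋙ stableLift E E' i hP ≅ stableLift E E' i hP ⋙ suspension E :=
  NatIso.ofComponents (fun X => cosyzygyIso E E' i hP hconf X.as) (by
    rintro ⟨X⟩ ⟨Y⟩ f
    obtain ⟨f, rfl⟩ := (toStable E').map_surjective (X := X) (Y := Y) f
    exact cosyzygyIso_naturality E E' i hP hconf f)

-- The image of a standard triangle is a pushout of the image of the chosen conflation of `A`, which
-- need not be the conflation chosen for `i.obj A`. Pushing the latter out along `i.map f` gives a
-- genuine standard triangle, and the hull comparisons make the two pushouts stably isomorphic,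
-- compatibly with `suspensionIso`.
include hconf in
lemma stableLift_isTriangleFunctor :
    IsTriangleFunctor E E' (stableLift E E' i hP) where
  additive := stableLift_additive E E' i hP
  exists_iso := by
    refine ⟨suspensionIso E E' i hP hconf, ?_⟩
    rintro X Y Z p q r ⟨A, B, M, f, g, h, a, b, c, ⟨w, t, hgh, ht, hth⟩, h₁, h₂, h₃⟩
    have hφ := hullComparison_τ₁ E E' i hconf A
    have hψ := hullComparisonInv_τ₁ E E' i hP A
    set φ := hullComparison E E' i hconf A
    set ψ := hullComparisonInv E E' i hP A
    have hconfA : E (mapHullComplex E' i A) := hconf _ (hull_conflation E' A)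
    have hghC : E (ShortComplex.mk (i.map g) (i.map h)
      (by rw [← i.map_comp, w, i.map_zero])) := hconf _ hgh
    have sq : IsPushout (i.map (hullι E' A)) (i.map f) (i.map t) (i.map g) :=
      IsExact.isPushout_of_ladder (E := E) hconfA hghC
        (by rw [← i.map_comp, ht, i.map_comp]) (by rw [← i.map_comp, hth])
    obtain ⟨M', g', t', h', w', sq', hgh', hth'⟩ :=
      IsExact.exists_pushout_conflation (hull_conflation E (i.obj A)) (i.map f)
    obtain ⟨e, he, he'⟩ := exists_stable_iso_of_ladders (E := E) hconfA
      (hull_conflation E (i.obj A)) (isProj_map_hull E E' i hP A)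
      ((hE.proj_iff_inj _).2 (isInj_hull E _)) sq (h := i.map h)
      (by rw [← i.map_comp, w, i.map_zero]) (by rw [← i.map_comp, hth]) sq' w' hth'
      (a := φ.τ₂) (c := φ.τ₃)
      (by have := φ.comm₁₂; rw [hφ] at this; exact this.symm.trans (Category.id_comp _))
      φ.comm₂₃.symm (a' := ψ.τ₂)
      (by have := ψ.comm₁₂; rw [hψ] at this; exact this.symm.trans (Category.id_comp _))
    let F := stableLift E E' i hP
    refine ⟨i.obj A, i.obj B, M', i.map f, g', h', F.mapIso a, F.mapIso b, F.mapIso c ≪≫ e,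
      ⟨w', t', hgh', sq'.w, hth'⟩, ?_, ?_, ?_⟩
    · exact (F.map_comp _ _).symm.trans ((congrArg F.map h₁).trans (F.map_comp _ _))
    · have h₂' : F.map q ≫ F.map c.hom = F.map b.hom ≫ (toStable E).map (i.map g) :=
        (F.map_comp _ _).symm.trans ((congrArg F.map h₂).trans (F.map_comp _ _))
      exact ladder_comp h₂' he
    · have h₃' : F.map r ≫ F.map ((suspension E').map a.hom) =
          F.map c.hom ≫ (toStable E).map (i.map h) :=
        (F.map_comp _ _).symm.trans ((congrArg F.map h₃).trans (F.map_comp _ _))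
      have nat := (suspensionIso E E' i hP hconf).hom.naturality a.hom
      exact ladder_comp_shift h₃' nat he'

end Induced

end ExactCat

/-! ### Vanishing of Ext along short exact sequences. -/

namespace CategoryTheory.ShortComplex.ShortExact

open CategoryTheory.Abelian

variable {S : Type u} [CommRing S] {T : ShortComplex (ModuleCat.{u} S)} (hT : T.ShortExact)
  {Y : ModuleCat.{u} S}

include hT

lemma subsingleton_ext_mid {n : ℕ} (h₁ : Subsingleton (Ext.{u} T.X₁ Y n))
    (h₃ : Subsingleton (Ext.{u} T.X₃ Y n)) : Subsingleton (Ext.{u} T.X₂ Y n) := by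
  refine subsingleton_of_forall_eq 0 fun x => ?_
  obtain ⟨y, rfl⟩ := Ext.contravariant_sequence_exact₂ hT Y x (Subsingleton.elim _ _)
  rw [Subsingleton.elim y 0, Ext.comp_zero]

lemma subsingleton_ext_left {n m : ℕ} (hm : 1 + n = m) (h₂ : Subsingleton (Ext.{u} T.X₂ Y n))
    (h₃ : Subsingleton (Ext.{u} T.X₃ Y m)) : Subsingleton (Ext.{u} T.X₁ Y n) := by
  refine subsingleton_of_forall_eq 0 fun x => ?_
  obtain ⟨y, rfl⟩ := Ext.contravariant_sequence_exact₁ hT Y x hm (Subsingleton.elim _ _)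
  rw [Subsingleton.elim y 0, Ext.comp_zero]

lemma subsingleton_ext_right {n m : ℕ} (hm : 1 + n = m) (h₁ : Subsingleton (Ext.{u} T.X₁ Y n))
    (h₂ : Subsingleton (Ext.{u} T.X₂ Y m)) : Subsingleton (Ext.{u} T.X₃ Y m) := by
  refine subsingleton_of_forall_eq 0 fun x => ?_
  obtain ⟨y, rfl⟩ := Ext.contravariant_sequence_exact₃ hT Y x (Subsingleton.elim _ _) hm
  rw [Subsingleton.elim y 0, Ext.comp_zero]

/-- The obstruction to extending `f` is its image under the connecting map to `Ext¹(T.X₃, Y)`. -/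
lemma exists_extension_of_subsingleton_ext (h₃ : Subsingleton (Ext.{u} T.X₃ Y 1))
    (f : T.X₁ ⟶ Y) : ∃ g : T.X₂ ⟶ Y, T.f ≫ g = f := by
  obtain ⟨y, hy⟩ := Ext.contravariant_sequence_exact₁ hT Y (Ext.mk₀ f) (add_zero 1)
    (Subsingleton.elim _ _)
  obtain ⟨g, rfl⟩ := (Ext.mk₀_bijective _ _).2 y
  rw [Ext.mk₀_comp_mk₀] at hy
  exact ⟨g, (Ext.mk₀_bijective _ _).1 hy⟩

/-- A class on `T.X₃` dies on `T.X₂`, so it is the connecting image of some `f`. As `f` extends over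
`T.X₂`, that image vanishes. -/
lemma subsingleton_ext_one_of_exists_extension (h : ∀ f : T.X₁ ⟶ Y, ∃ g : T.X₂ ⟶ Y, T.f ≫ g = f)
    (h₂ : Subsingleton (Ext.{u} T.X₂ Y 1)) : Subsingleton (Ext.{u} T.X₃ Y 1) := by
  refine subsingleton_of_forall_eq 0 fun x => ?_
  obtain ⟨y, rfl⟩ := Ext.contravariant_sequence_exact₃ hT Y x (Subsingleton.elim _ _) (add_zero 1)
  obtain ⟨f, rfl⟩ := (Ext.mk₀_bijective _ _).2 y
  obtain ⟨g, rfl⟩ := h f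
  rw [← Ext.mk₀_comp_mk₀, ← Ext.comp_assoc (a₁₂ := 1) _ _ _ (by simp) (by simp) (by simp),
    hT.extClass_comp, Ext.zero_comp]

end CategoryTheory.ShortComplex.ShortExact

/-! ### Dual sequences and biduality. -/

namespace ModuleCat

variable {S : Type u} [CommRing S]

/-- The dual module `Hom(M, S)`. -/
abbrev dual (M : ModuleCat.{u} S) : ModuleCat.{u} S := of S (Module.Dual S M)

/-- The dual of a short complex of modules. -/
abbrev dualComplex (T : ShortComplex (ModuleCat.{u} S)) : ShortComplex (ModuleCat.{u} S) :=
  ShortComplex.mk (X₁ := dual T.X₃) (X₂ := dual T.X₂) (X₃ := dual T.X₁)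
    (ofHom T.g.hom.dualMap) (ofHom T.f.hom.dualMap) (by
      ext φ x
      change φ (T.g.hom (T.f.hom x)) = 0
      rw [T.moduleCat_zero_apply, map_zero])

/-- Dualizing is always left exact; the hypothesis `h` is precisely surjectivity at the right end.
-/
lemma shortExact_dualComplex {T : ShortComplex (ModuleCat.{u} S)} (hT : T.ShortExact)
    (h : ∀ f : T.X₁ ⟶ of S S, ∃ g : T.X₂ ⟶ of S S, T.f ≫ g = f) :
    (dualComplex T).ShortExact := by
  refine shortComplex_shortExact _ ?_ ?_ ?_
  · intro φ
    constructor
    · intro hφ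
      have := hT.epi_g
      have hφ' : T.f ≫ ofHom φ = 0 := by
        ext x
        exact LinearMap.congr_fun hφ x
      refine ⟨(hT.exact.desc (ofHom φ) hφ').hom, ?_⟩
      exact congrArg ModuleCat.Hom.hom (hT.exact.g_desc (ofHom φ) hφ')
    · rintro ⟨ψ, rfl⟩
      exact congrArg (fun k => k.hom ψ) (dualComplex T).zero
  · exact LinearMap.dualMap_injective_of_surjective hT.moduleCat_surjective_g
  · intro φ
    obtain ⟨g, hg⟩ := h (ofHom φ)
    exact ⟨g.hom, congrArg ModuleCat.Hom.hom hg⟩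

section Biduality

variable {T : ShortComplex (ModuleCat.{u} S)} (hT : T.ShortExact)
  (hT' : (dualComplex (dualComplex T)).ShortExact)

include hT hT'

/-- Evaluation is a map from `T` to its double dual, so this and the next two lemmas are instances
of the five lemma. -/
lemma bijective_eval_left (h₂ : Function.Bijective (Module.Dual.eval S T.X₂))
    (h₃ : Function.Bijective (Module.Dual.eval S T.X₃)) :
    Function.Bijective (Module.Dual.eval S T.X₁) :=
  LinearMap.bijective_of_bijective_of_injective_of_left_exact T.f.hom T.g.hom
    T.f.hom.dualMap.dualMap T.g.hom.dualMap.dualMap _ (Module.Dual.eval S T.X₂)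
    (Module.Dual.eval S T.X₃) rfl rfl
    ((ShortComplex.ShortExact.moduleCat_exact_iff_function_exact _).1 hT.exact)
    ((ShortComplex.ShortExact.moduleCat_exact_iff_function_exact _).1 hT'.exact) h₂ h₃.1
    hT.moduleCat_injective_f hT'.moduleCat_injective_f

lemma bijective_eval_right (h₁ : Function.Bijective (Module.Dual.eval S T.X₁))
    (h₂ : Function.Bijective (Module.Dual.eval S T.X₂)) :
    Function.Bijective (Module.Dual.eval S T.X₃) :=
  LinearMap.bijective_of_surjective_of_bijective_of_right_exact T.f.hom T.g.hom
    T.f.hom.dualMap.dualMap T.g.hom.dualMap.dualMap (Module.Dual.eval S T.X₁)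
    (Module.Dual.eval S T.X₂) _ rfl rfl
    ((ShortComplex.ShortExact.moduleCat_exact_iff_function_exact _).1 hT.exact)
    ((ShortComplex.ShortExact.moduleCat_exact_iff_function_exact _).1 hT'.exact) h₁.2 h₂
    hT.moduleCat_surjective_g hT'.moduleCat_surjective_g

lemma bijective_eval_mid (h₁ : Function.Bijective (Module.Dual.eval S T.X₁))
    (h₃ : Function.Bijective (Module.Dual.eval S T.X₃)) :
    Function.Bijective (Module.Dual.eval S T.X₂) := by
  have e := (ShortComplex.ShortExact.moduleCat_exact_iff_function_exact _).1 hT.exact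
  have e' := (ShortComplex.ShortExact.moduleCat_exact_iff_function_exact _).1 hT'.exact
  exact LinearMap.bijective_of_surjective_of_bijective_of_bijective_of_injective
    (0 : PUnit.{u + 1} →ₗ[S] T.X₁) T.f.hom T.g.hom (0 : T.X₃ →ₗ[S] PUnit.{u + 1})
    (0 : PUnit.{u + 1} →ₗ[S] _) T.f.hom.dualMap.dualMap T.g.hom.dualMap.dualMap
    (0 : _ →ₗ[S] PUnit.{u + 1}) 0 (Module.Dual.eval S T.X₁) _ (Module.Dual.eval S T.X₃) 0
    (by rw [LinearMap.comp_zero, LinearMap.comp_zero]) rfl rfl (by ext)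
    ((LinearMap.exact_zero_iff_injective _ _).2 hT.moduleCat_injective_f) e
    ((LinearMap.exact_zero_iff_surjective _ _).2 hT.moduleCat_surjective_g)
    ((LinearMap.exact_zero_iff_injective _ _).2 hT'.moduleCat_injective_f) e'
    ((LinearMap.exact_zero_iff_surjective _ _).2 hT'.moduleCat_surjective_g)
    (fun x => ⟨0, Subsingleton.elim _ _⟩) h₁ h₃ (fun _ _ _ => Subsingleton.elim _ _)

end Biduality

/-- If maps to `S` extend along `i`, then so do maps to finitely generated projective modules. -/
lemma exists_extension_of_fgProj {A B : ModuleCat.{u} S} (i : A ⟶ B)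
    (h : ∀ f : A ⟶ of S S, ∃ g : B ⟶ of S S, i ≫ g = f) {P : ModuleCat.{u} S}
    (hP : fgProj S P) (f : A ⟶ P) : ∃ g : B ⟶ P, i ≫ g = f := by
  obtain ⟨_, _⟩ := hP
  obtain ⟨n, r, s, -, -, hrs⟩ := Module.Finite.exists_comp_eq_id_of_projective S P
  -- `P` is a retract of `Sⁿ` through `s` and `r`: extend each coordinate of `s ∘ f`, then apply
  -- `r`.
  choose g hg using fun k : Fin n => h (ofHom (LinearMap.proj k ∘ₗ s ∘ₗ f.hom))
  refine ⟨ofHom (r ∘ₗ LinearMap.pi fun k => (g k).hom), ?_⟩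
  ext x
  have hx : (fun k => (g k).hom (i.hom x)) = s (f.hom x) := by
    funext k
    exact LinearMap.congr_fun (congrArg ModuleCat.Hom.hom (hg k)) x
  change r (fun k => (g k).hom (i.hom x)) = f.hom x
  rw [hx]
  exact LinearMap.congr_fun hrs (f.hom x)

end ModuleCat

/-! ### Frobenius classes of modules, and the finitely generated projectives as an example. -/

lemma fgProj_of_retract {S : Type u} [CommRing S] {X P : ModuleCat.{u} S} (s : X ⟶ P) (r : P ⟶ X)
    (h : s ≫ r = 𝟙 X) (hP : fgProj S P) : fgProj S X := by
  obtain ⟨_, _⟩ := hP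
  have hrs : r.hom ∘ₗ s.hom = LinearMap.id := congrArg ModuleCat.Hom.hom h
  exact ⟨Module.Finite.of_surjective r.hom fun x => ⟨s.hom x, LinearMap.congr_fun hrs x⟩,
    Module.Projective.of_split s.hom r.hom hrs⟩

/-- The closure properties of a class `Q` of modules under which the matrix factorizations with
terms in `Q` form a Frobenius category. -/
structure IsFrobeniusClass {S : Type u} [CommRing S] (Q : ObjectProperty (ModuleCat.{u} S)) :
    Prop where
  fgProj_le : fgProj S ≤ Q
  extension : ∀ T : ShortComplex (ModuleCat.{u} S), T.ShortExact → Q T.X₁ → Q T.X₃ → Q T.X₂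
  kernel : ∀ T : ShortComplex (ModuleCat.{u} S), T.ShortExact → Q T.X₂ → Q T.X₃ → Q T.X₁
  -- Closure under cokernels of all monomorphisms would be too much: multiplication by a
  -- non-zerodivisor on `S` is a monomorphism of free modules. The extension condition stands in for
  -- the vanishing of `Ext¹(T.X₃, P)`.
  cokernel : ∀ T : ShortComplex (ModuleCat.{u} S), T.ShortExact → Q T.X₁ → Q T.X₂ →
    (∀ P, fgProj S P → ∀ f : T.X₁ ⟶ P, ∃ g, T.f ≫ g = f) → Q T.X₃
  exists_extension : ∀ T : ShortComplex (ModuleCat.{u} S), T.ShortExact → Q T.X₃ →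
    ∀ P, fgProj S P → ∀ f : T.X₁ ⟶ P, ∃ g, T.f ≫ g = f
  exists_epi : ∀ M, Q M → ∃ (P : ModuleCat.{u} S) (p : P ⟶ M), fgProj S P ∧ Epi p
  exists_mono : ∀ M, Q M → ∃ (P : ModuleCat.{u} S) (i : M ⟶ P), fgProj S P ∧ Mono i ∧
    ∀ P', fgProj S P' → ∀ f : M ⟶ P', ∃ g, i ≫ g = f

lemma ModuleCat.exists_fgProj_epi {S : Type u} [CommRing S] (M : ModuleCat.{u} S)
    [Module.Finite S M] : ∃ (P : ModuleCat.{u} S) (p : P ⟶ M), fgProj S P ∧ Epi p := by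
  obtain ⟨n, f, hf⟩ := Module.Finite.exists_fin' S M
  exact ⟨.of S (Fin n → S), ofHom f, ⟨inferInstanceAs (Module.Finite S (Fin n → S)),
    inferInstanceAs (Module.Projective S (Fin n → S))⟩, (ModuleCat.epi_iff_surjective _).2 hf⟩

lemma isFrobeniusClass_fgProj (S : Type u) [CommRing S] : IsFrobeniusClass (fgProj S) := by
  have split : ∀ T : ShortComplex (ModuleCat.{u} S), T.ShortExact → fgProj S T.X₃ →
      Nonempty T.Splitting := fun T hT h₃ => by
    have : Module.Projective S T.X₃ := h₃.2
    have : Projective T.X₃ := (IsProjective.iff_projective (R := S) _).1 inferInstance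
    exact ⟨hT.splittingOfProjective⟩
  refine ⟨le_rfl, ?_, ?_, ?_, ?_, ?_, ?_⟩
  · intro T hT h₁ h₃
    obtain ⟨σ⟩ := split T hT h₃
    obtain ⟨_, _⟩ := h₁
    obtain ⟨_, _⟩ := h₃
    refine ⟨Module.Finite.of_exact
      ((ShortComplex.ShortExact.moduleCat_exact_iff_function_exact _).1 hT.exact)
      hT.moduleCat_surjective_g, ?_⟩
    have : Projective T.X₁ := (IsProjective.iff_projective (R := S) _).1 inferInstance
    have : Projective T.X₃ := (IsProjective.iff_projective (R := S) _).1 inferInstance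
    exact (IsProjective.iff_projective (R := S) _).2
      (Projective.of_iso σ.isoBinaryBiproduct.symm inferInstance)
  · intro T hT h₂ h₃
    obtain ⟨σ⟩ := split T hT h₃
    exact fgProj_of_retract T.f σ.r σ.f_r h₂
  · intro T hT h₁ h₂ h
    -- `T.X₁` is itself projective, so its identity extends and the sequence splits.
    obtain ⟨r, hr⟩ := h _ h₁ (𝟙 _)
    have σ := ShortComplex.Splitting.ofExactOfRetraction T hT.exact r hr hT.epi_g
    exact fgProj_of_retract σ.s T.g σ.s_g h₂
  · intro T hT h₃ P _ f
    obtain ⟨σ⟩ := split T hT h₃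
    exact ⟨σ.r ≫ f, by rw [← Category.assoc, σ.f_r, Category.id_comp]⟩
  · rintro M ⟨_, _⟩
    exact M.exists_fgProj_epi
  · intro M hM
    exact ⟨M, 𝟙 M, hM, inferInstance, fun _ _ f => ⟨f, Category.id_comp f⟩⟩

/-! ### Closure properties of finitely generated Gorenstein projectives. -/

section Gorenstein

open ModuleCat CategoryTheory.Abelian

variable {S : Type u} [CommRing S]

lemma fgGorProj.exists_extension {T : ShortComplex (ModuleCat.{u} S)} (hT : T.ShortExact)
    (h₃ : fgGorProj S T.X₃) (f : T.X₁ ⟶ of S S) : ∃ g, T.f ≫ g = f :=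
  hT.exists_extension_of_subsingleton_ext (h₃.ext_eq_zero 1 le_rfl) f

/-- The dual sequence ends in the dual of `T.X₁`, so the obstruction to dualizing again lies in the
vanishing group `Ext¹(T.X₁*, S)`. -/
lemma fgGorProj.shortExact_bidual {T : ShortComplex (ModuleCat.{u} S)}
    (h₁ : fgGorProj S T.X₁) (hd : (dualComplex T).ShortExact) :
    (dualComplex (dualComplex T)).ShortExact :=
  shortExact_dualComplex hd
    (hd.exists_extension_of_subsingleton_ext (h₁.ext_dual_eq_zero 1 le_rfl))

lemma fgGorProj.extension {T : ShortComplex (ModuleCat.{u} S)} (hT : T.ShortExact)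
    (h₁ : fgGorProj S T.X₁) (h₃ : fgGorProj S T.X₃) : fgGorProj S T.X₂ := by
  have hd := shortExact_dualComplex hT (h₃.exists_extension hT)
  have := h₁.finite
  have := h₃.finite
  exact
  { finite := Module.Finite.of_exact
      ((ShortComplex.ShortExact.moduleCat_exact_iff_function_exact _).1 hT.exact)
      hT.moduleCat_surjective_g
    ext_eq_zero := fun i hi => hT.subsingleton_ext_mid (h₁.ext_eq_zero i hi) (h₃.ext_eq_zero i hi)
    ext_dual_eq_zero := fun i hi =>
      hd.subsingleton_ext_mid (h₃.ext_dual_eq_zero i hi) (h₁.ext_dual_eq_zero i hi)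
    biduality := bijective_eval_mid hT (h₁.shortExact_bidual hd) h₁.biduality h₃.biduality }

lemma fgGorProj.cokernel {T : ShortComplex (ModuleCat.{u} S)} (hT : T.ShortExact)
    (h₁ : fgGorProj S T.X₁) (h₂ : fgGorProj S T.X₂)
    (h : ∀ f : T.X₁ ⟶ of S S, ∃ g, T.f ≫ g = f) : fgGorProj S T.X₃ := by
  have hd := shortExact_dualComplex hT h
  have := h₂.finite
  exact
  { finite := Module.Finite.of_surjective T.g.hom hT.moduleCat_surjective_g
    ext_eq_zero := fun i hi => by
      -- In degree one the preceding term is `Hom(T.X₁, S)`, which does not vanish, so `h` is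
      -- needed; in higher degrees both neighbouring Ext groups are zero.
      obtain ⟨_ | i, rfl⟩ := Nat.exists_eq_add_of_le hi
      · exact hT.subsingleton_ext_one_of_exists_extension h (h₂.ext_eq_zero 1 le_rfl)
      · exact hT.subsingleton_ext_right rfl (h₁.ext_eq_zero (i + 1) (by omega))
          (h₂.ext_eq_zero _ hi)
    ext_dual_eq_zero := fun i hi =>
      hd.subsingleton_ext_left (m := 1 + i) rfl (h₂.ext_dual_eq_zero i hi)
        (h₁.ext_dual_eq_zero _ (by omega))
    biduality := bijective_eval_right hT (h₁.shortExact_bidual hd) h₁.biduality h₂.biduality }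

lemma fgGorProj.kernel [IsNoetherianRing S] {T : ShortComplex (ModuleCat.{u} S)}
    (hT : T.ShortExact) (h₂ : fgGorProj S T.X₂) (h₃ : fgGorProj S T.X₃) : fgGorProj S T.X₁ := by
  have hd := shortExact_dualComplex hT (h₃.exists_extension hT)
  have := h₂.finite
  -- By biduality a functional on the dual of `T.X₃` is evaluation at a point `x`; evaluation at a
  -- preimage `y` of `x` in `T.X₂` extends it. This replaces knowledge of `Ext¹(T.X₁*, S)`, which is
  -- not yet available.
  have hext : ∀ f : (dualComplex T).X₁ ⟶ of S S, ∃ g, (dualComplex T).f ≫ g = f := by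
    intro f
    obtain ⟨x, hx⟩ := h₃.biduality.2 f.hom
    obtain ⟨y, rfl⟩ := hT.moduleCat_surjective_g x
    refine ⟨ofHom (Module.Dual.eval S T.X₂ y), ?_⟩
    ext φ
    exact LinearMap.congr_fun hx φ
  exact
  { finite := Module.Finite.of_injective T.f.hom hT.moduleCat_injective_f
    ext_eq_zero := fun i hi =>
      hT.subsingleton_ext_left (m := 1 + i) rfl (h₂.ext_eq_zero i hi)
        (h₃.ext_eq_zero _ (by omega))
    ext_dual_eq_zero := fun i hi => by
      obtain ⟨_ | i, rfl⟩ := Nat.exists_eq_add_of_le hi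
      · exact hd.subsingleton_ext_one_of_exists_extension hext (h₂.ext_dual_eq_zero 1 le_rfl)
      · exact hd.subsingleton_ext_right rfl (h₃.ext_dual_eq_zero (i + 1) (by omega))
          (h₂.ext_dual_eq_zero _ hi)
    biduality := bijective_eval_left hT (shortExact_dualComplex hd hext) h₂.biduality
      h₃.biduality }

/-- Passing to the dual exchanges the two Ext conditions, up to transport along `M ≅ M**`. Finite
generation holds because `M*` embeds into the dual of a finitely generated projective over a
noetherian ring. -/
lemma fgGorProj.dual [IsNoetherianRing S] {M : ModuleCat.{u} S} (hM : fgGorProj S M) :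
    fgGorProj S (dual M) := by
  have := hM.finite
  let e : M ≅ ModuleCat.dual (ModuleCat.dual M) :=
    (LinearEquiv.ofBijective (Module.Dual.eval S M) hM.biduality).toModuleIso
  exact
  { finite := by
      obtain ⟨P, p, ⟨_, _⟩, hp⟩ := M.exists_fgProj_epi
      have : Module.Finite S (Module.Dual S P) := inferInstance
      exact Module.Finite.of_injective p.hom.dualMap
        (LinearMap.dualMap_injective_of_surjective ((ModuleCat.epi_iff_surjective p).1 hp))
    ext_eq_zero := hM.ext_dual_eq_zero
    ext_dual_eq_zero := fun i hi => by
      have := hM.ext_eq_zero i hi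
      refine subsingleton_of_forall_eq 0 fun x => ?_
      have h : (Ext.mk₀ e.inv).comp ((Ext.mk₀ e.hom).comp x (zero_add i)) (zero_add i) = x := by
        rw [Ext.mk₀_comp_mk₀_assoc, e.inv_hom_id, Ext.mk₀_id_comp]
      rw [← h, Subsingleton.elim ((Ext.mk₀ e.hom).comp x (zero_add i)) 0, Ext.comp_zero]
    biduality := by
      -- The triangle identity for biduality: evaluation on `M*` followed by the transpose of
      -- evaluation on `M` is the identity, and the transpose is bijective.
      have hbij : Function.Bijective (Module.Dual.eval S M).dualMap :=
        (LinearEquiv.ofBijective (Module.Dual.eval S M) hM.biduality).dualMap.bijective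
      have hid : (Module.Dual.eval S M).dualMap ∘ Module.Dual.eval S (Module.Dual S M) = id := rfl
      exact (Function.Bijective.of_comp_iff' hbij _).1 (hid ▸ Function.bijective_id) }

/-- Dualize a surjection `p : P ⟶ M*` to embed `M ≅ M**` into `P*`. A functional on `M` has the form
`p x`, and evaluation at `x` extends it to `P*`. -/
lemma fgGorProj.exists_mono [IsNoetherianRing S] {M : ModuleCat.{u} S} (hM : fgGorProj S M) :
    ∃ (P : ModuleCat.{u} S) (i : M ⟶ P), fgProj S P ∧ Mono i ∧
      ∀ f : M ⟶ of S S, ∃ g, i ≫ g = f := by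
  have := hM.dual.finite
  obtain ⟨P, p, hP, hp⟩ := (ModuleCat.dual M).exists_fgProj_epi
  obtain ⟨_, _⟩ := hP
  have hsurj := (ModuleCat.epi_iff_surjective p).1 hp
  refine ⟨ModuleCat.dual P, ofHom (p.hom.dualMap ∘ₗ Module.Dual.eval S M),
    ⟨inferInstanceAs (Module.Finite S (Module.Dual S P)),
      inferInstanceAs (Module.Projective S (Module.Dual S P))⟩, ?_, ?_⟩
  · rw [ModuleCat.mono_iff_injective]
    exact (LinearMap.dualMap_injective_of_surjective hsurj).comp hM.biduality.1
  · intro f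
    obtain ⟨x, hx⟩ := hsurj f.hom
    refine ⟨ofHom (Module.Dual.eval S P x), ?_⟩
    ext m
    exact LinearMap.congr_fun hx m

lemma isFrobeniusClass_fgGorProj (S : Type u) [CommRing S] [IsNoetherianRing S] :
    IsFrobeniusClass (fgGorProj S) where
  fgProj_le := fgProj_le_fgGorProj S
  extension _ hT h₁ h₃ := h₁.extension hT h₃
  kernel _ hT h₂ h₃ := h₂.kernel hT h₃
  cokernel _ hT h₁ h₂ h := h₁.cokernel hT h₂ (h _ ⟨inferInstanceAs (Module.Finite S S),
    inferInstanceAs (Module.Projective S S)⟩)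
  exists_extension _ hT h₃ _ hP f := exists_extension_of_fgProj _ (h₃.exists_extension hT) hP f
  exists_epi M hM := by
    have := hM.finite
    exact M.exists_fgProj_epi
  exists_mono M hM := by
    obtain ⟨P, i, hP, hi, h⟩ := hM.exists_mono
    exact ⟨P, i, hP, hi, fun P' hP' f => exists_extension_of_fgProj i h hP' f⟩

end Gorenstein

/-! ### Consequences of the closure properties. -/

namespace IsFrobeniusClass

variable {S : Type u} [CommRing S] {Q : ObjectProperty (ModuleCat.{u} S)} (hQ : IsFrobeniusClass Q)

include hQ

lemma of_isZero {M : ModuleCat.{u} S} (hM : IsZero M) : Q M := by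
  have : Subsingleton M := ModuleCat.subsingleton_of_isZero hM
  exact hQ.fgProj_le _ ⟨inferInstance, inferInstance⟩

/-- An isomorphism is an extension whose third term is zero. -/
lemma of_iso {M N : ModuleCat.{u} S} (e : M ≅ N) (hM : Q M) : Q N :=
  hQ.extension (ShortComplex.mk e.hom (0 : N ⟶ ModuleCat.of S PUnit) comp_zero)
    { exact := (ShortComplex.exact_iff_epi _ rfl).2 inferInstance
      mono_f := inferInstanceAs (Mono e.hom)
      epi_g := ⟨fun _ _ _ => (ModuleCat.isZero_of_subsingleton _).eq_of_src _ _⟩ } hM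
    (hQ.of_isZero (ModuleCat.isZero_of_subsingleton _))

lemma biprod {M N : ModuleCat.{u} S} (hM : Q M) (hN : Q N) : Q (M ⊞ N) :=
  hQ.extension _ (ShortComplex.Splitting.ofHasBinaryBiproduct M N).shortExact hM hN

lemma of_cokernel {M N : ModuleCat.{u} S} (i : M ⟶ N) [Mono i] (hM : Q M)
    (h : Q (Limits.cokernel i)) : Q N :=
  hQ.extension (ShortComplex.mk i (cokernel.π i) (cokernel.condition i))
    { exact := ShortComplex.exact_cokernel i } hM h

lemma kernel_of_epi {M N : ModuleCat.{u} S} (p : M ⟶ N) [Epi p] (hM : Q M)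
    (hN : Q N) : Q (Limits.kernel p) :=
  hQ.kernel (ShortComplex.mk (kernel.ι p) p (kernel.condition p))
    { exact := ShortComplex.exact_kernel p } hM hN

lemma cokernel_of_mono {M N : ModuleCat.{u} S} (i : M ⟶ N) [Mono i] (hM : Q M) (hN : Q N)
    (h : ∀ P, fgProj S P → ∀ f : M ⟶ P, ∃ g, i ≫ g = f) : Q (Limits.cokernel i) :=
  hQ.cokernel (ShortComplex.mk i (cokernel.π i) (cokernel.condition i))
    { exact := ShortComplex.exact_cokernel i } hM hN h

lemma cokernel_of_shortExact {T : ShortComplex (ModuleCat.{u} S)} (hT : T.ShortExact)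
    (h : Q T.X₃) : Q (Limits.cokernel T.f) :=
  have := hT.epi_g
  hQ.of_iso (hT.exact.gIsCokernel.coconePointUniqueUpToIso (colimit.isColimit _)) h

/-- The cokernel of `i ≫ j` is an extension of that of `j` by that of `i`. This makes composites of
inflations inflations. -/
lemma cokernel_comp {L M N : ModuleCat.{u} S} (i : L ⟶ M) (j : M ⟶ N) [Mono i] [Mono j]
    (hi : Q (Limits.cokernel i)) (hj : Q (Limits.cokernel j)) : Q (Limits.cokernel (i ≫ j)) := by
  have hex : ∀ {A B : ModuleCat.{u} S} (k : A ⟶ B) (b : B), (cokernel.π k).hom b = 0 →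
      ∃ a, k.hom a = b := fun k b hb =>
    (ShortComplex.ShortExact.moduleCat_exact_iff_function_exact _).1
      (ShortComplex.exact_cokernel k) b |>.1 hb
  have hsurj : ∀ {A B : ModuleCat.{u} S} (k : A ⟶ B), Function.Surjective (cokernel.π k).hom :=
    fun k => (ModuleCat.epi_iff_surjective _).1 inferInstance
  have hcond : ∀ {A B : ModuleCat.{u} S} (k : A ⟶ B) (a : A),
      (cokernel.π k).hom (k.hom a) = 0 := fun k a =>
    LinearMap.congr_fun (congrArg ModuleCat.Hom.hom (cokernel.condition k)) a
  let a : Limits.cokernel i ⟶ Limits.cokernel (i ≫ j) :=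
    cokernel.map i (i ≫ j) (𝟙 L) j (by simp)
  let b : Limits.cokernel (i ≫ j) ⟶ Limits.cokernel j :=
    cokernel.map (i ≫ j) j i (𝟙 N) (by simp)
  have ha : ∀ m, a.hom ((cokernel.π i).hom m) = (cokernel.π (i ≫ j)).hom (j.hom m) := fun m =>
    LinearMap.congr_fun (congrArg ModuleCat.Hom.hom
      (show cokernel.π i ≫ a = j ≫ cokernel.π (i ≫ j) by simp [a])) m
  have hb : ∀ n, b.hom ((cokernel.π (i ≫ j)).hom n) = (cokernel.π j).hom n := fun n =>
    LinearMap.congr_fun (congrArg ModuleCat.Hom.hom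
      (show cokernel.π (i ≫ j) ≫ b = cokernel.π j by simp [b])) n
  have hab : a ≫ b = 0 := by
    rw [← cancel_epi (cokernel.π i)]
    simp [a, b]
  refine hQ.extension (ShortComplex.mk a b hab)
    (ModuleCat.shortComplex_shortExact _ ?_ ?_ ?_) hi hj
  · intro w
    refine ⟨fun hw => ?_, ?_⟩
    · obtain ⟨n, rfl⟩ := hsurj _ w
      obtain ⟨m, rfl⟩ := hex j n ((hb n).symm.trans hw)
      exact ⟨_, ha m⟩
    · rintro ⟨x, rfl⟩
      exact LinearMap.congr_fun (congrArg ModuleCat.Hom.hom hab) x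
  · refine (injective_iff_map_eq_zero a.hom).2 fun x hx => ?_
    obtain ⟨m, rfl⟩ := hsurj _ x
    obtain ⟨l, hl⟩ := hex (i ≫ j) (j.hom m) ((ha m).symm.trans hx)
    have : i.hom l = m := (ModuleCat.mono_iff_injective j).1 inferInstance hl
    rw [← this, hcond]
  · intro y
    obtain ⟨n, rfl⟩ := hsurj _ y
    exact ⟨_, hb n⟩

lemma cokernel_of_isPushout {L M N P : ModuleCat.{u} S} {i : L ⟶ M} {f : L ⟶ N} {t : M ⟶ P}
    {g : N ⟶ P} (sq : IsPushout i f t g) (h : Q (Limits.cokernel i)) : Q (Limits.cokernel g) :=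
  have := isIso_cokernel_map_of_isPushout sq.flip
  have := isIso_cokernel_map_of_isPushout sq
  hQ.of_iso (asIso (cokernel.map i g f t sq.w)) h

lemma kernel_of_isPullback {P M N L : ModuleCat.{u} S} {f : P ⟶ M} {q : P ⟶ N} {p : M ⟶ L}
    {k : N ⟶ L} (sq : IsPullback f q p k) (h : Q (Limits.kernel p)) : Q (Limits.kernel q) :=
  have := isIso_kernel_map_of_isPullback sq.flip
  hQ.of_iso (asIso (kernel.map q p f k sq.w.symm)).symm h

lemma of_kernel {M N : ModuleCat.{u} S} (p : M ⟶ N) [Epi p] (hK : Q (Limits.kernel p))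
    (hN : Q N) : Q M :=
  hQ.extension (ShortComplex.mk (kernel.ι p) p (kernel.condition p))
    { exact := ShortComplex.exact_kernel p } hK hN

end IsFrobeniusClass

/-! ### Componentwise constructions and contractible matrix factorizations. -/

namespace MatFact

variable {S : Type u} [CommRing S] {ω : S}

lemma comm₁ {X Y : MatFact S ω} (f : X ⟶ Y) : f.f₁ ≫ Y.d₁ = X.d₁ ≫ f.f₀ := f.comm₁

lemma comm₀ {X Y : MatFact S ω} (f : X ⟶ Y) : f.f₀ ≫ Y.d₀ = X.d₀ ≫ f.f₁ := f.comm₀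

lemma d₁_comp_d₀_comp (X : MatFact S ω) {M : ModuleCat.{u} S} (h : X.X₁ ⟶ M) :
    X.d₁ ≫ X.d₀ ≫ h = ω • h := by
  rw [← Category.assoc, d₁_d₀, Linear.smul_comp, Category.id_comp]

lemma d₀_comp_d₁_comp (X : MatFact S ω) {M : ModuleCat.{u} S} (h : X.X₀ ⟶ M) :
    X.d₀ ≫ X.d₁ ≫ h = ω • h := by
  rw [← Category.assoc, d₀_d₁, Linear.smul_comp, Category.id_comp]

/-- Constructor for morphisms of matrix factorizations. -/
@[simps]
def mkHom {X Y : MatFact S ω} (f₁ : X.X₁ ⟶ Y.X₁) (f₀ : X.X₀ ⟶ Y.X₀)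
    (h₁ : f₁ ≫ Y.d₁ = X.d₁ ≫ f₀) (h₀ : f₀ ≫ Y.d₀ = X.d₀ ≫ f₁) : X ⟶ Y :=
  Hom.mk f₁ f₀ h₁ h₀

/-- The zero matrix factorization. -/
noncomputable abbrev zeroObj (S : Type u) [CommRing S] (ω : S) : MatFact S ω where
  X₁ := .of S PUnit
  X₀ := .of S PUnit
  d₁ := 0
  d₀ := 0
  d₁_d₀ := (ModuleCat.isZero_of_subsingleton _).eq_of_src _ _
  d₀_d₁ := (ModuleCat.isZero_of_subsingleton _).eq_of_src _ _

/-- The direct sum of two matrix factorizations. -/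
noncomputable abbrev sum (X Y : MatFact S ω) : MatFact S ω where
  X₁ := X.X₁ ⊞ Y.X₁
  X₀ := X.X₀ ⊞ Y.X₀
  d₁ := biprod.map X.d₁ Y.d₁
  d₀ := biprod.map X.d₀ Y.d₀
  d₁_d₀ := by apply biprod.hom_ext' <;> simp [d₁_comp_d₀_comp]
  d₀_d₁ := by apply biprod.hom_ext' <;> simp [d₀_comp_d₁_comp]

/-- The cokernel of a morphism of matrix factorizations. -/
noncomputable abbrev coker {X Y : MatFact S ω} (f : X ⟶ Y) : MatFact S ω where
  X₁ := cokernel f.f₁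
  X₀ := cokernel f.f₀
  d₁ := cokernel.map _ _ X.d₁ Y.d₁ f.comm₁
  d₀ := cokernel.map _ _ X.d₀ Y.d₀ f.comm₀
  d₁_d₀ := by
    rw [← cancel_epi (cokernel.π _)]
    simp [d₁_comp_d₀_comp]
  d₀_d₁ := by
    rw [← cancel_epi (cokernel.π _)]
    simp [d₀_comp_d₁_comp]

/-- The kernel of a morphism of matrix factorizations. -/
noncomputable abbrev ker {X Y : MatFact S ω} (f : X ⟶ Y) : MatFact S ω where
  X₁ := kernel f.f₁
  X₀ := kernel f.f₀
  d₁ := kernel.map _ _ X.d₁ Y.d₁ f.comm₁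
  d₀ := kernel.map _ _ X.d₀ Y.d₀ f.comm₀
  d₁_d₀ := by
    rw [← cancel_mono (kernel.ι _)]
    simp [d₁_d₀]
  d₀_d₁ := by
    rw [← cancel_mono (kernel.ι _)]
    simp [d₀_d₁]

/-- The pushout of matrix factorizations. -/
noncomputable abbrev pushoutObj {X Y Z : MatFact S ω} (f : X ⟶ Y) (g : X ⟶ Z) : MatFact S ω where
  X₁ := pushout f.f₁ g.f₁
  X₀ := pushout f.f₀ g.f₀
  d₁ := pushout.desc (Y.d₁ ≫ pushout.inl _ _) (Z.d₁ ≫ pushout.inr _ _) (by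
    rw [← Category.assoc, comm₁ f, Category.assoc, pushout.condition, ← Category.assoc,
      ← comm₁ g, Category.assoc])
  d₀ := pushout.desc (Y.d₀ ≫ pushout.inl _ _) (Z.d₀ ≫ pushout.inr _ _) (by
    rw [← Category.assoc, comm₀ f, Category.assoc, pushout.condition, ← Category.assoc,
      ← comm₀ g, Category.assoc])
  d₁_d₀ := by
    apply pushout.hom_ext <;> simp [pushout.inl_desc, pushout.inr_desc, pushout.inl_desc_assoc, pushout.inr_desc_assoc, d₁_comp_d₀_comp]
  d₀_d₁ := by
    apply pushout.hom_ext <;> simp [pushout.inl_desc, pushout.inr_desc, pushout.inl_desc_assoc, pushout.inr_desc_assoc, d₀_comp_d₁_comp]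

/-- The pullback of matrix factorizations. -/
noncomputable abbrev pullbackObj {X Y Z : MatFact S ω} (f : X ⟶ Z) (g : Y ⟶ Z) : MatFact S ω where
  X₁ := pullback f.f₁ g.f₁
  X₀ := pullback f.f₀ g.f₀
  d₁ := pullback.lift (pullback.fst _ _ ≫ X.d₁) (pullback.snd _ _ ≫ Y.d₁) (by
    rw [Category.assoc, ← comm₁ f, ← Category.assoc, pullback.condition, Category.assoc,
      comm₁ g, Category.assoc])
  d₀ := pullback.lift (pullback.fst _ _ ≫ X.d₀) (pullback.snd _ _ ≫ Y.d₀) (by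
    rw [Category.assoc, ← comm₀ f, ← Category.assoc, pullback.condition, Category.assoc,
      comm₀ g, Category.assoc])
  d₁_d₀ := by
    apply pullback.hom_ext <;> simp [pullback.lift_fst, pullback.lift_snd, pullback.lift_fst_assoc,
      pullback.lift_snd_assoc, d₁_d₀]
  d₀_d₁ := by
    apply pullback.hom_ext <;> simp [pullback.lift_fst, pullback.lift_snd, pullback.lift_fst_assoc,
      pullback.lift_snd_assoc, d₀_d₁]

/-- The contractible matrix factorization `(F₁ ⊕ F₀ ⇄ F₁ ⊕ F₀)` with structure maps
`diag(1, ω)` and `diag(ω, 1)`. -/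
noncomputable abbrev contractible (ω : S) (F₁ F₀ : ModuleCat.{u} S) : MatFact S ω where
  X₁ := F₁ ⊞ F₀
  X₀ := F₁ ⊞ F₀
  d₁ := biprod.map (𝟙 _) (ω • 𝟙 _)
  d₀ := biprod.map (ω • 𝟙 _) (𝟙 _)
  d₁_d₀ := by apply biprod.hom_ext' <;> simp
  d₀_d₁ := by apply biprod.hom_ext' <;> simp

variable {F₁ F₀ : ModuleCat.{u} S}

/-- Morphisms out of a contractible matrix factorization. -/
noncomputable def fromContractible {X : MatFact S ω} (a : F₁ ⟶ X.X₁) (b : F₀ ⟶ X.X₀) :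
    contractible ω F₁ F₀ ⟶ X :=
  mkHom (X := contractible ω F₁ F₀) (biprod.desc a (b ≫ X.d₀)) (biprod.desc (a ≫ X.d₁) b)
    (by apply biprod.hom_ext' <;> simp [d₀_d₁]) (by apply biprod.hom_ext' <;> simp [d₁_d₀])

/-- On each summand one of the structure maps is the identity, so commutation forces the remaining
two components. With `fromContractible` this identifies maps to `X` with pairs `F₁ ⟶ X.X₁`, `F₀ ⟶
X.X₀`. -/
lemma fromContractible_ext {X : MatFact S ω} {f g : contractible ω F₁ F₀ ⟶ X}
    (h₁ : biprod.inl ≫ f.f₁ = biprod.inl ≫ g.f₁) (h₀ : biprod.inr ≫ f.f₀ = biprod.inr ≫ g.f₀) :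
    f = g := by
  have hl : ∀ k : contractible ω F₁ F₀ ⟶ X,
      biprod.inl ≫ k.f₀ = (biprod.inl ≫ k.f₁) ≫ X.d₁ := fun k => by
    rw [Category.assoc, comm₁ k]
    simp
  have hr : ∀ k : contractible ω F₁ F₀ ⟶ X,
      biprod.inr ≫ k.f₁ = (biprod.inr ≫ k.f₀) ≫ X.d₀ := fun k => by
    rw [Category.assoc, comm₀ k]
    simp
  ext1
  · exact biprod.hom_ext' _ _ h₁ (by rw [hr, hr, h₀])
  · exact biprod.hom_ext' _ _ (by rw [hl, hl, h₁]) h₀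

/-- Morphisms into a contractible matrix factorization. -/
noncomputable def toContractible {X : MatFact S ω} (a : X.X₀ ⟶ F₁) (b : X.X₁ ⟶ F₀) :
    X ⟶ contractible ω F₁ F₀ :=
  mkHom (Y := contractible ω F₁ F₀) (biprod.lift (X.d₁ ≫ a) b) (biprod.lift a (X.d₀ ≫ b))
    (by apply biprod.hom_ext <;> simp [d₁_comp_d₀_comp])
    (by apply biprod.hom_ext <;> simp [d₀_comp_d₁_comp])

/-- Dual to `fromContractible_ext`, with the indices crossed: the free data are maps `X.X₀ ⟶ F₁` and
`X.X₁ ⟶ F₀`. -/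
lemma toContractible_ext {X : MatFact S ω} {f g : X ⟶ contractible ω F₁ F₀}
    (h₁ : f.f₁ ≫ biprod.snd = g.f₁ ≫ biprod.snd) (h₀ : f.f₀ ≫ biprod.fst = g.f₀ ≫ biprod.fst) :
    f = g := by
  have hl : ∀ k : X ⟶ contractible ω F₁ F₀,
      k.f₁ ≫ biprod.fst = X.d₁ ≫ k.f₀ ≫ biprod.fst := fun k => by
    rw [← Category.assoc, ← comm₁ k]
    simp
  have hr : ∀ k : X ⟶ contractible ω F₁ F₀,
      k.f₀ ≫ biprod.snd = X.d₀ ≫ k.f₁ ≫ biprod.snd := fun k => by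
    rw [← Category.assoc, ← comm₀ k]
    simp
  ext1
  · exact biprod.hom_ext _ _ (by rw [hl, hl, h₀]) h₁
  · exact biprod.hom_ext _ _ h₀ (by rw [hr, hr, h₁])

end MatFact

/-! ### The exact and Frobenius structures on matrix factorizations with terms in `Q`. -/

namespace MF

variable {S : Type u} [CommRing S] {Q : ObjectProperty (ModuleCat.{u} S)} {ω : S}

/-- The row of first components of a short complex of matrix factorizations. -/
abbrev row₁ (T : ShortComplex (MF Q ω)) : ShortComplex (ModuleCat.{u} S) :=
  ShortComplex.mk T.f.hom.f₁ T.g.hom.f₁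
    (congrArg (fun k : T.X₁ ⟶ T.X₃ => k.hom.f₁) T.zero)

/-- The row of zeroth components of a short complex of matrix factorizations. -/
abbrev row₀ (T : ShortComplex (MF Q ω)) : ShortComplex (ModuleCat.{u} S) :=
  ShortComplex.mk T.f.hom.f₀ T.g.hom.f₀
    (congrArg (fun k : T.X₁ ⟶ T.X₃ => k.hom.f₀) T.zero)

lemma conflation_iff (T : ShortComplex (MF Q ω)) :
    conflation Q ω T ↔ (row₁ T).ShortExact ∧ (row₀ T).ShortExact := Iff.rfl

lemma hom_ext {X Y : MF Q ω} {f g : X ⟶ Y} (h₁ : f.hom.f₁ = g.hom.f₁) (h₀ : f.hom.f₀ = g.hom.f₀) :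
    f = g :=
  ObjectProperty.hom_ext _ (MatFact.hom_ext h₁ h₀)

/-- Constructor for morphisms in `MF Q ω`. -/
abbrev mkHom {X Y : MF Q ω} (f₁ : X.obj.X₁ ⟶ Y.obj.X₁) (f₀ : X.obj.X₀ ⟶ Y.obj.X₀)
    (h₁ : f₁ ≫ Y.obj.d₁ = X.obj.d₁ ≫ f₀) (h₀ : f₀ ≫ Y.obj.d₀ = X.obj.d₀ ≫ f₁) : X ⟶ Y :=
  ObjectProperty.homMk (MatFact.mkHom f₁ f₀ h₁ h₀)

lemma congr_f₁ {X Y : MF Q ω} {f g : X ⟶ Y} (h : f = g) : f.hom.f₁ = g.hom.f₁ := by rw [h]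

lemma congr_f₀ {X Y : MF Q ω} {f g : X ⟶ Y} (h : f = g) : f.hom.f₀ = g.hom.f₀ := by rw [h]

lemma isPushout_of_components {X Y Z W : MF Q ω} {f : X ⟶ Y} {g : X ⟶ Z} {h : Y ⟶ W}
    {k : Z ⟶ W} (s₁ : IsPushout f.hom.f₁ g.hom.f₁ h.hom.f₁ k.hom.f₁)
    (s₀ : IsPushout f.hom.f₀ g.hom.f₀ h.hom.f₀ k.hom.f₀) : IsPushout f g h k :=
  IsPushout.of_isColimit' ⟨hom_ext s₁.w s₀.w⟩ (PushoutCocone.IsColimit.mk _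
    (fun s => mkHom (s₁.desc s.inl.hom.f₁ s.inr.hom.f₁ (congr_f₁ s.condition))
      (s₀.desc s.inl.hom.f₀ s.inr.hom.f₀ (congr_f₀ s.condition))
      (by
        apply s₁.hom_ext
        · rw [← Category.assoc, s₁.inl_desc, ← Category.assoc, MatFact.comm₁ h.hom, Category.assoc,
            s₀.inl_desc, MatFact.comm₁]
        · rw [← Category.assoc, s₁.inr_desc, ← Category.assoc, MatFact.comm₁ k.hom, Category.assoc,
            s₀.inr_desc, MatFact.comm₁])
      (by
        apply s₀.hom_ext
        · rw [← Category.assoc, s₀.inl_desc, ← Category.assoc, MatFact.comm₀ h.hom, Category.assoc,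
            s₁.inl_desc, MatFact.comm₀]
        · rw [← Category.assoc, s₀.inr_desc, ← Category.assoc, MatFact.comm₀ k.hom, Category.assoc,
            s₁.inr_desc, MatFact.comm₀]))
    (fun s => hom_ext (s₁.inl_desc _ _ _) (s₀.inl_desc _ _ _))
    (fun s => hom_ext (s₁.inr_desc _ _ _) (s₀.inr_desc _ _ _))
    (fun s m h₁ h₂ => hom_ext
      (s₁.hom_ext ((congr_f₁ h₁).trans (s₁.inl_desc _ _ _).symm)
        ((congr_f₁ h₂).trans (s₁.inr_desc _ _ _).symm))
      (s₀.hom_ext ((congr_f₀ h₁).trans (s₀.inl_desc _ _ _).symm)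
        ((congr_f₀ h₂).trans (s₀.inr_desc _ _ _).symm))))

lemma isPullback_of_components {X Y Z W : MF Q ω} {h : W ⟶ X} {k : W ⟶ Y} {f : X ⟶ Z}
    {g : Y ⟶ Z} (s₁ : IsPullback h.hom.f₁ k.hom.f₁ f.hom.f₁ g.hom.f₁)
    (s₀ : IsPullback h.hom.f₀ k.hom.f₀ f.hom.f₀ g.hom.f₀) : IsPullback h k f g :=
  IsPullback.of_isLimit' ⟨hom_ext s₁.w s₀.w⟩ (PullbackCone.IsLimit.mk _
    (fun s => mkHom (s₁.lift s.fst.hom.f₁ s.snd.hom.f₁ (congr_f₁ s.condition))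
      (s₀.lift s.fst.hom.f₀ s.snd.hom.f₀ (congr_f₀ s.condition))
      (by
        apply s₀.hom_ext
        · rw [Category.assoc, Category.assoc, s₀.lift_fst, ← MatFact.comm₁ h.hom, ← Category.assoc,
            s₁.lift_fst, MatFact.comm₁]
        · rw [Category.assoc, Category.assoc, s₀.lift_snd, ← MatFact.comm₁ k.hom, ← Category.assoc,
            s₁.lift_snd, MatFact.comm₁])
      (by
        apply s₁.hom_ext
        · rw [Category.assoc, Category.assoc, s₁.lift_fst, ← MatFact.comm₀ h.hom, ← Category.assoc,
            s₀.lift_fst, MatFact.comm₀]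
        · rw [Category.assoc, Category.assoc, s₁.lift_snd, ← MatFact.comm₀ k.hom, ← Category.assoc,
            s₀.lift_snd, MatFact.comm₀]))
    (fun s => hom_ext (s₁.lift_fst _ _ _) (s₀.lift_fst _ _ _))
    (fun s => hom_ext (s₁.lift_snd _ _ _) (s₀.lift_snd _ _ _))
    (fun s m h₁ h₂ => hom_ext
      (s₁.hom_ext ((congr_f₁ h₁).trans (s₁.lift_fst _ _ _).symm)
        ((congr_f₁ h₂).trans (s₁.lift_snd _ _ _).symm))
      (s₀.hom_ext ((congr_f₀ h₁).trans (s₀.lift_fst _ _ _).symm)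
        ((congr_f₀ h₂).trans (s₀.lift_snd _ _ _).symm))))

lemma conflation_kernel (T : ShortComplex (MF Q ω)) (hT : conflation Q ω T) :
    Nonempty (IsLimit (KernelFork.ofι T.f T.zero)) := by
  obtain ⟨h₁, h₀⟩ := (conflation_iff T).1 hT
  have m₁ : Mono T.f.hom.f₁ := h₁.mono_f
  have m₀ : Mono T.f.hom.f₀ := h₀.mono_f
  have l₁ : ∀ {M : ModuleCat.{u} S} (k : M ⟶ T.X₂.obj.X₁) (hk : k ≫ T.g.hom.f₁ = 0),
      h₁.exact.lift k hk ≫ T.f.hom.f₁ = k := fun k hk => h₁.exact.lift_f k hk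
  have l₀ : ∀ {M : ModuleCat.{u} S} (k : M ⟶ T.X₂.obj.X₀) (hk : k ≫ T.g.hom.f₀ = 0),
      h₀.exact.lift k hk ≫ T.f.hom.f₀ = k := fun k hk => h₀.exact.lift_f k hk
  refine ⟨KernelFork.IsLimit.ofι _ _
    (fun {W} k hk => mkHom (h₁.exact.lift k.hom.f₁ (congr_f₁ hk))
      (h₀.exact.lift k.hom.f₀ (congr_f₀ hk)) ?_ ?_) ?_ ?_⟩
  · rw [← cancel_mono T.f.hom.f₀, Category.assoc, Category.assoc, l₀, ← MatFact.comm₁ T.f.hom,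
      ← Category.assoc, l₁, MatFact.comm₁]
  · rw [← cancel_mono T.f.hom.f₁, Category.assoc, Category.assoc, l₁, ← MatFact.comm₀ T.f.hom,
      ← Category.assoc, l₀, MatFact.comm₀]
  · exact fun k hk => hom_ext (l₁ _ _) (l₀ _ _)
  · exact fun k hk m hm => hom_ext
      ((cancel_mono T.f.hom.f₁).1 ((congr_f₁ hm).trans (l₁ _ _).symm))
      ((cancel_mono T.f.hom.f₀).1 ((congr_f₀ hm).trans (l₀ _ _).symm))

lemma conflation_cokernel (T : ShortComplex (MF Q ω)) (hT : conflation Q ω T) :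
    Nonempty (IsColimit (CokernelCofork.ofπ T.g T.zero)) := by
  obtain ⟨h₁, h₀⟩ := (conflation_iff T).1 hT
  have m₁ : Epi T.g.hom.f₁ := h₁.epi_g
  have m₀ : Epi T.g.hom.f₀ := h₀.epi_g
  have l₁ : ∀ {M : ModuleCat.{u} S} (k : T.X₂.obj.X₁ ⟶ M) (hk : T.f.hom.f₁ ≫ k = 0),
      T.g.hom.f₁ ≫ h₁.exact.desc k hk = k := fun k hk => h₁.exact.g_desc k hk
  have l₀ : ∀ {M : ModuleCat.{u} S} (k : T.X₂.obj.X₀ ⟶ M) (hk : T.f.hom.f₀ ≫ k = 0),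
      T.g.hom.f₀ ≫ h₀.exact.desc k hk = k := fun k hk => h₀.exact.g_desc k hk
  refine ⟨CokernelCofork.IsColimit.ofπ _ _
    (fun {W} k hk => mkHom (h₁.exact.desc k.hom.f₁ (congr_f₁ hk))
      (h₀.exact.desc k.hom.f₀ (congr_f₀ hk)) ?_ ?_) ?_ ?_⟩
  · rw [← cancel_epi T.g.hom.f₁, ← Category.assoc, l₁, ← Category.assoc, MatFact.comm₁ T.g.hom,
      Category.assoc, l₀, MatFact.comm₁]
  · rw [← cancel_epi T.g.hom.f₀, ← Category.assoc, l₀, ← Category.assoc, MatFact.comm₀ T.g.hom,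
      Category.assoc, l₁, MatFact.comm₀]
  · exact fun k hk => hom_ext (l₁ _ _) (l₀ _ _)
  · exact fun k hk m hm => hom_ext
      ((cancel_epi T.g.hom.f₁).1 ((congr_f₁ hm).trans (l₁ _ _).symm))
      ((cancel_epi T.g.hom.f₀).1 ((congr_f₀ hm).trans (l₀ _ _).symm))

variable (hQ : IsFrobeniusClass Q)

include hQ

/-- The cokernel conditions have no counterpart in `deflation_iff`, since `Q` is closed under
kernels of epimorphisms but not under cokernels of arbitrary monomorphisms. -/
lemma inflation_iff {X Y : MF Q ω} (i : X ⟶ Y) :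
    ExactCat.Inflation (conflation Q ω) i ↔ (Mono i.hom.f₁ ∧ Q (cokernel i.hom.f₁)) ∧
      Mono i.hom.f₀ ∧ Q (cokernel i.hom.f₀) := by
  constructor
  · rintro ⟨Z, p, w, h⟩
    obtain ⟨h₁, h₀⟩ := (conflation_iff _).1 h
    exact ⟨⟨h₁.mono_f, hQ.cokernel_of_shortExact h₁ Z.property.1⟩,
      h₀.mono_f, hQ.cokernel_of_shortExact h₀ Z.property.2⟩
  · rintro ⟨⟨m₁, q₁⟩, m₀, q₀⟩
    refine ⟨⟨MatFact.coker i.hom, q₁, q₀⟩, mkHom (cokernel.π _) (cokernel.π _) (by simp) (by simp),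
      hom_ext (cokernel.condition _) (cokernel.condition _), (conflation_iff _).2 ⟨?_, ?_⟩⟩
    · exact { exact := ShortComplex.exact_cokernel i.hom.f₁
              mono_f := m₁
              epi_g := inferInstanceAs (Epi (cokernel.π i.hom.f₁)) }
    · exact { exact := ShortComplex.exact_cokernel i.hom.f₀
              mono_f := m₀
              epi_g := inferInstanceAs (Epi (cokernel.π i.hom.f₀)) }

lemma deflation_iff {X Y : MF Q ω} (p : X ⟶ Y) :
    ExactCat.Deflation (conflation Q ω) p ↔ Epi p.hom.f₁ ∧ Epi p.hom.f₀ := by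
  constructor
  · rintro ⟨Z, p, w, h⟩
    obtain ⟨h₁, h₀⟩ := (conflation_iff _).1 h
    exact ⟨h₁.epi_g, h₀.epi_g⟩
  · rintro ⟨m₁, m₀⟩
    refine ⟨⟨MatFact.ker p.hom, hQ.kernel_of_epi _ X.property.1 Y.property.1,
      hQ.kernel_of_epi _ X.property.2 Y.property.2⟩,
      mkHom (kernel.ι _) (kernel.ι _) (by simp) (by simp),
      hom_ext (kernel.condition _) (kernel.condition _), (conflation_iff _).2 ⟨?_, ?_⟩⟩
    · exact { exact := ShortComplex.exact_kernel p.hom.f₁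
              mono_f := inferInstanceAs (Mono (kernel.ι p.hom.f₁))
              epi_g := m₁ }
    · exact { exact := ShortComplex.exact_kernel p.hom.f₀
              mono_f := inferInstanceAs (Mono (kernel.ι p.hom.f₀))
              epi_g := m₀ }

lemma hasFiniteBiproducts : HasFiniteBiproducts (MF Q ω) := by
  have : HasZeroObject (MF Q ω) := ⟨⟨⟨MatFact.zeroObj S ω,
      hQ.of_isZero (ModuleCat.isZero_of_subsingleton _),
      hQ.of_isZero (ModuleCat.isZero_of_subsingleton _)⟩, (IsZero.iff_id_eq_zero _).2
        (hom_ext ((ModuleCat.isZero_of_subsingleton _).eq_of_src _ _)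
          ((ModuleCat.isZero_of_subsingleton _).eq_of_src _ _))⟩⟩
  have : HasBinaryBiproducts (MF Q ω) := ⟨fun X Y => hasBinaryBiproduct_of_total
    { pt := ⟨MatFact.sum X.obj Y.obj, hQ.biprod X.property.1 Y.property.1,
        hQ.biprod X.property.2 Y.property.2⟩
      fst := mkHom biprod.fst biprod.fst (by simp) (by simp)
      snd := mkHom biprod.snd biprod.snd (by simp) (by simp)
      inl := mkHom biprod.inl biprod.inl (by simp) (by simp)
      inr := mkHom biprod.inr biprod.inr (by simp) (by simp)
      inl_fst := hom_ext biprod.inl_fst biprod.inl_fst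
      inl_snd := hom_ext biprod.inl_snd biprod.inl_snd
      inr_fst := hom_ext biprod.inr_fst biprod.inr_fst
      inr_snd := hom_ext biprod.inr_snd biprod.inr_snd }
    (hom_ext biprod.total biprod.total)⟩
  have : HasFiniteProducts (MF Q ω) := hasFiniteProducts_of_has_binary_and_terminal
  exact HasFiniteBiproducts.of_hasFiniteProducts

lemma isExact : ExactCat.IsExact (conflation Q ω) where
  hasFiniteBiproducts := hasFiniteBiproducts hQ
  isClosedUnderIsomorphisms := ⟨fun e h =>
    ⟨ShortComplex.shortExact_of_iso (((hasTerms Q ω).ι ⋙ MatFact.ev₁).mapShortComplex.mapIso e) h.1,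
      ShortComplex.shortExact_of_iso (((hasTerms Q ω).ι ⋙ MatFact.ev₀).mapShortComplex.mapIso e)
        h.2⟩⟩
  kernel := conflation_kernel
  cokernel := conflation_cokernel
  inflation_id X := (inflation_iff hQ _).2
    ⟨⟨inferInstanceAs (Mono (𝟙 X.obj.X₁)), hQ.of_isZero (isZero_cokernel_of_epi (𝟙 X.obj.X₁))⟩,
      inferInstanceAs (Mono (𝟙 X.obj.X₀)), hQ.of_isZero (isZero_cokernel_of_epi (𝟙 X.obj.X₀))⟩
  deflation_id X := (deflation_iff hQ _).2
    ⟨inferInstanceAs (Epi (𝟙 X.obj.X₁)), inferInstanceAs (Epi (𝟙 X.obj.X₀))⟩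
  inflation_comp i j hi hj := by
    obtain ⟨⟨_, q₁⟩, _, q₀⟩ := (inflation_iff hQ i).1 hi
    obtain ⟨⟨_, q₁'⟩, _, q₀'⟩ := (inflation_iff hQ j).1 hj
    exact (inflation_iff hQ _).2
      ⟨⟨mono_comp i.hom.f₁ j.hom.f₁, hQ.cokernel_comp i.hom.f₁ j.hom.f₁ q₁ q₁'⟩,
        mono_comp i.hom.f₀ j.hom.f₀, hQ.cokernel_comp i.hom.f₀ j.hom.f₀ q₀ q₀'⟩
  deflation_comp p q hp hq := by
    obtain ⟨_, _⟩ := (deflation_iff hQ p).1 hp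
    obtain ⟨_, _⟩ := (deflation_iff hQ q).1 hq
    exact (deflation_iff hQ _).2 ⟨epi_comp p.hom.f₁ q.hom.f₁, epi_comp p.hom.f₀ q.hom.f₀⟩
  pushout {X Y X'} i f hi := by
    obtain ⟨⟨_, q₁⟩, _, q₀⟩ := (inflation_iff hQ i).1 hi
    have s₁ := IsPushout.of_hasPushout i.hom.f₁ f.hom.f₁
    have s₀ := IsPushout.of_hasPushout i.hom.f₀ f.hom.f₀
    -- Cokernels are unchanged by pushout, so each component of the pushout is an extension of a
    -- module in `Q` by a component of `X'`. The pullback axiom uses kernels in the same way.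
    have c₁ := hQ.cokernel_of_isPushout s₁ q₁
    have c₀ := hQ.cokernel_of_isPushout s₀ q₀
    have m₁ : Mono (pushout.inr i.hom.f₁ f.hom.f₁) := inferInstance
    have m₀ : Mono (pushout.inr i.hom.f₀ f.hom.f₀) := inferInstance
    refine ⟨⟨MatFact.pushoutObj i.hom f.hom, hQ.of_cokernel _ X'.property.1 c₁,
      hQ.of_cokernel _ X'.property.2 c₀⟩,
      mkHom (pushout.inl _ _) (pushout.inl _ _) (pushout.inl_desc _ _ _) (pushout.inl_desc _ _ _),
      mkHom (pushout.inr _ _) (pushout.inr _ _) (pushout.inr_desc _ _ _) (pushout.inr_desc _ _ _),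
      isPushout_of_components s₁ s₀, (inflation_iff hQ _).2 ⟨⟨m₁, c₁⟩, m₀, c₀⟩⟩
  pullback {Y Z Z'} p f hp := by
    obtain ⟨_, _⟩ := (deflation_iff hQ p).1 hp
    have s₁ := IsPullback.of_hasPullback p.hom.f₁ f.hom.f₁
    have s₀ := IsPullback.of_hasPullback p.hom.f₀ f.hom.f₀
    have c₁ := hQ.kernel_of_isPullback s₁ (hQ.kernel_of_epi _ Y.property.1 Z.property.1)
    have c₀ := hQ.kernel_of_isPullback s₀ (hQ.kernel_of_epi _ Y.property.2 Z.property.2)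
    have m₁ : Epi (pullback.snd p.hom.f₁ f.hom.f₁) := inferInstance
    have m₀ : Epi (pullback.snd p.hom.f₀ f.hom.f₀) := inferInstance
    refine ⟨⟨MatFact.pullbackObj p.hom f.hom, hQ.of_kernel _ c₁ Z'.property.1,
      hQ.of_kernel _ c₀ Z'.property.2⟩,
      mkHom (pullback.fst _ _) (pullback.fst _ _) (pullback.lift_fst _ _ _).symm
        (pullback.lift_fst _ _ _).symm,
      mkHom (pullback.snd _ _) (pullback.snd _ _) (pullback.lift_snd _ _ _).symm
        (pullback.lift_snd _ _ _).symm,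
      isPullback_of_components s₁ s₀, (deflation_iff hQ _).2 ⟨m₁, m₀⟩⟩

/-- The contractible matrix factorization on two finitely generated projective modules. -/
noncomputable abbrev contractible (ω : S) {F₁ F₀ : ModuleCat.{u} S} (h₁ : fgProj S F₁)
    (h₀ : fgProj S F₀) : MF Q ω :=
  ⟨MatFact.contractible ω F₁ F₀,
    hQ.fgProj_le _ ((isFrobeniusClass_fgProj S).biprod h₁ h₀),
    hQ.fgProj_le _ ((isFrobeniusClass_fgProj S).biprod h₁ h₀)⟩

section

variable {F₁ F₀ : ModuleCat.{u} S} (h₁ : fgProj S F₁) (h₀ : fgProj S F₀)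

/-- Only the two maps from `F₁` and `F₀` have to be lifted along the component epimorphisms;
compatibility with the structure maps is then automatic. -/
lemma isProj_contractible : ExactCat.IsProj (conflation Q ω) (contractible hQ ω h₁ h₀) := by
  intro Y Z p hp f
  obtain ⟨_, _⟩ := (deflation_iff hQ p).1 hp
  have := h₁.2
  have := h₀.2
  have : Projective F₁ := (IsProjective.iff_projective (R := S) _).1 inferInstance
  have : Projective F₀ := (IsProjective.iff_projective (R := S) _).1 inferInstance
  let a : F₁ ⟶ Z.obj.X₁ := biprod.inl ≫ f.hom.f₁
  let b : F₀ ⟶ Z.obj.X₀ := biprod.inr ≫ f.hom.f₀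
  refine ⟨ObjectProperty.homMk (MatFact.fromContractible (Projective.factorThru a p.hom.f₁)
    (Projective.factorThru b p.hom.f₀)), ObjectProperty.hom_ext _
      (MatFact.fromContractible_ext ?_ ?_)⟩
  · change biprod.inl ≫ biprod.desc _ _ ≫ p.hom.f₁ = a
    rw [← Category.assoc, biprod.inl_desc, Projective.factorThru_comp]
  · change biprod.inr ≫ biprod.desc _ _ ≫ p.hom.f₀ = b
    rw [← Category.assoc, biprod.inr_desc, Projective.factorThru_comp]

/-- Only the maps `X₀ ⟶ F₁` and `X₁ ⟶ F₀` have to be extended, which is possible because the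
cokernels of the components lie in `Q`. -/
lemma isInj_contractible : ExactCat.IsInj (conflation Q ω) (contractible hQ ω h₁ h₀) := by
  rintro X Y i ⟨Z, p, w, h⟩ f
  obtain ⟨e₁, e₀⟩ := (conflation_iff _).1 h
  let a : X.obj.X₀ ⟶ F₁ := f.hom.f₀ ≫ biprod.fst
  let b : X.obj.X₁ ⟶ F₀ := f.hom.f₁ ≫ biprod.snd
  obtain ⟨a', ha⟩ := hQ.exists_extension _ e₀ Z.property.2 _ h₁ a
  obtain ⟨b', hb⟩ := hQ.exists_extension _ e₁ Z.property.1 _ h₀ b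
  refine ⟨ObjectProperty.homMk (MatFact.toContractible a' b'), ObjectProperty.hom_ext _
      (MatFact.toContractible_ext ?_ ?_)⟩
  · change (i.hom.f₁ ≫ biprod.lift _ _) ≫ biprod.snd = b
    rw [Category.assoc, biprod.lift_snd, ← hb]
  · change (i.hom.f₀ ≫ biprod.lift _ _) ≫ biprod.fst = a
    rw [Category.assoc, biprod.lift_fst, ← ha]

end

lemma exists_deflation_contractible (X : MF Q ω) :
    ∃ (F₁ F₀ : ModuleCat.{u} S) (h₁ : fgProj S F₁) (h₀ : fgProj S F₀)
      (p : contractible hQ ω h₁ h₀ ⟶ X), ExactCat.Deflation (conflation Q ω) p := by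
  obtain ⟨F₁, a, h₁, _⟩ := hQ.exists_epi _ X.property.1
  obtain ⟨F₀, b, h₀, _⟩ := hQ.exists_epi _ X.property.2
  refine ⟨F₁, F₀, h₁, h₀, ObjectProperty.homMk (MatFact.fromContractible a b),
    (deflation_iff hQ _).2 ⟨?_, ?_⟩⟩
  · exact epi_of_epi_fac (biprod.inl_desc a (b ≫ X.obj.d₀))
  · exact epi_of_epi_fac (biprod.inr_desc (a ≫ X.obj.d₁) b)

lemma exists_inflation_contractible (X : MF Q ω) :
    ∃ (F₁ F₀ : ModuleCat.{u} S) (h₁ : fgProj S F₁) (h₀ : fgProj S F₀)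
      (i : X ⟶ contractible hQ ω h₁ h₀), ExactCat.Inflation (conflation Q ω) i := by
  -- The indices cross, as for all maps into a contractible factorization: `F₁` receives `X₀` and
  -- `F₀` receives `X₁`.
  obtain ⟨F₁, a, h₁, _, ha⟩ := hQ.exists_mono _ X.property.2
  obtain ⟨F₀, b, h₀, _, hb⟩ := hQ.exists_mono _ X.property.1
  have hF : Q (F₁ ⊞ F₀) := hQ.fgProj_le _ ((isFrobeniusClass_fgProj S).biprod h₁ h₀)
  have m₁ : Mono (biprod.lift (X.obj.d₁ ≫ a) b) := mono_of_mono_fac (biprod.lift_snd _ b)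
  have m₀ : Mono (biprod.lift a (X.obj.d₀ ≫ b)) := mono_of_mono_fac (biprod.lift_fst a _)
  refine ⟨F₁, F₀, h₁, h₀, ObjectProperty.homMk (MatFact.toContractible a b),
    (inflation_iff hQ _).2 ⟨⟨m₁, hQ.cokernel_of_mono (biprod.lift (X.obj.d₁ ≫ a) b) X.property.1 hF
      fun P hP f => ?_⟩, m₀, hQ.cokernel_of_mono (biprod.lift a (X.obj.d₀ ≫ b)) X.property.2 hF
      fun P hP f => ?_⟩⟩
  -- A map to a projective already extends along the single coordinate `b`, hence along the whole
  -- embedding, so the cokernel stays in `Q`.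
  · obtain ⟨g, rfl⟩ := hb P hP f
    exact ⟨biprod.snd ≫ g, by rw [← Category.assoc, biprod.lift_snd]⟩
  · obtain ⟨g, rfl⟩ := ha P hP f
    exact ⟨biprod.fst ≫ g, by rw [← Category.assoc, biprod.lift_fst]⟩

/-- A projective object is a retract of a contractible matrix factorization. -/
lemma exists_retract_of_isProj {X : MF Q ω} (hX : ExactCat.IsProj (conflation Q ω) X) :
    ∃ (F₁ F₀ : ModuleCat.{u} S) (h₁ : fgProj S F₁) (h₀ : fgProj S F₀)
      (s : X ⟶ contractible hQ ω h₁ h₀) (r : contractible hQ ω h₁ h₀ ⟶ X), s ≫ r = 𝟙 X := by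
  obtain ⟨F₁, F₀, h₁, h₀, p, hp⟩ := exists_deflation_contractible hQ X
  obtain ⟨s, hs⟩ := hX p hp (𝟙 X)
  exact ⟨F₁, F₀, h₁, h₀, s, p, hs⟩

lemma isFrobenius : ExactCat.IsFrobenius (conflation Q ω) where
  toIsExact := isExact hQ
  enoughProj X := by
    obtain ⟨F₁, F₀, h₁, h₀, p, hp⟩ := exists_deflation_contractible hQ X
    exact ⟨_, p, isProj_contractible hQ h₁ h₀, hp⟩
  enoughInj X := by
    obtain ⟨F₁, F₀, h₁, h₀, i, hi⟩ := exists_inflation_contractible hQ X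
    exact ⟨_, i, isInj_contractible hQ h₁ h₀, hi⟩
  proj_iff_inj X := by
    constructor
    · intro hX
      obtain ⟨F₁, F₀, h₁, h₀, s, r, hsr⟩ := exists_retract_of_isProj hQ hX
      exact ExactCat.IsInj.of_retract s r hsr (isInj_contractible hQ h₁ h₀)
    · intro hX
      obtain ⟨F₁, F₀, h₁, h₀, i, hi⟩ := exists_inflation_contractible hQ X
      obtain ⟨r, hr⟩ := hX i hi (𝟙 X)
      exact ExactCat.IsProj.of_retract i r hr (isProj_contractible hQ h₁ h₀)

/-- Its components are retracts of those of a contractible factorization. Enlarging `Q` therefore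
creates no projective object outside `MF(ω, 𝒫)`. -/
lemma hasTerms_fgProj_of_isProj {X : MF Q ω} (hX : ExactCat.IsProj (conflation Q ω) X) :
    hasTerms (fgProj S) ω X.obj := by
  obtain ⟨F₁, F₀, h₁, h₀, s, r, hsr⟩ := exists_retract_of_isProj hQ hX
  have hF := (isFrobeniusClass_fgProj S).biprod h₁ h₀
  exact ⟨fgProj_of_retract s.hom.f₁ r.hom.f₁ (congr_f₁ hsr) hF,
    fgProj_of_retract s.hom.f₀ r.hom.f₀ (congr_f₀ hsr) hF⟩

end MF

/-! ### Comparison of the projective and Gorenstein projective cases. -/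

section Comparison

variable {S : Type u} [CommRing S] {ω : S}

open MF

instance : (MF.incl ω).Full :=
  (ObjectProperty.fullyFaithfulιOfLE (hasTerms_mono (fgProj_le_fgGorProj S) ω)).full

instance : (MF.incl ω).Faithful :=
  (ObjectProperty.fullyFaithfulιOfLE (hasTerms_mono (fgProj_le_fgGorProj S) ω)).faithful

lemma MF.conflation_map_incl_iff (T : ShortComplex (MF (fgProj S) ω)) :
    conflation (fgProj S) ω T ↔ conflation (fgGorProj S) ω (T.map (MF.incl ω)) := Iff.rfl

lemma MF.incl_essImage_iff (X : MF (fgGorProj S) ω) :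
    (MF.incl ω).essImage X ↔ hasTerms (fgProj S) ω X.obj := by
  constructor
  · rintro ⟨Y, ⟨e⟩⟩
    have hP := isFrobeniusClass_fgProj S
    have e' := ((hasTerms (fgGorProj S) ω).ι).mapIso e
    exact ⟨hP.of_iso (MatFact.ev₁.mapIso e') Y.property.1,
      hP.of_iso (MatFact.ev₀.mapIso e') Y.property.2⟩
  · exact fun h => ⟨⟨X.obj, h⟩, ⟨Iso.refl _⟩⟩

/-- Being a retract of a contractible factorization is preserved by the inclusion. Conversely,
deflations of the small category remain deflations in the large one, and fullness brings the lift
back. -/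
lemma MF.isProj_incl_iff [IsNoetherianRing S] (X : MF (fgProj S) ω) :
    ExactCat.IsProj (conflation (fgProj S) ω) X ↔
      ExactCat.IsProj (conflation (fgGorProj S) ω) ((MF.incl ω).obj X) := by
  constructor
  · intro hX
    obtain ⟨F₁, F₀, h₁, h₀, s, r, hsr⟩ :=
      exists_retract_of_isProj (isFrobeniusClass_fgProj S) hX
    exact ExactCat.IsProj.of_retract ((MF.incl ω).map s) ((MF.incl ω).map r)
      (by rw [← (MF.incl ω).map_comp, hsr, (MF.incl ω).map_id])
      (isProj_contractible (isFrobeniusClass_fgGorProj S) h₁ h₀)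
  · intro hX Y Z p hp f
    obtain ⟨W, i, w, h⟩ := hp
    obtain ⟨g, hg⟩ := hX ((MF.incl ω).map p)
      ⟨(MF.incl ω).obj W, (MF.incl ω).map i, by rw [← (MF.incl ω).map_comp, w, Functor.map_zero],
        (conflation_map_incl_iff _).1 h⟩ ((MF.incl ω).map f)
    exact ⟨(MF.incl ω).preimage g, (MF.incl ω).map_injective (by simp [hg])⟩

variable (ω) in
lemma MF.incl_isAdmissibleSubcategory [IsNoetherianRing S] :
    ExactCat.IsAdmissibleSubcategory (conflation (fgGorProj S) ω) (conflation (fgProj S) ω)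
      (MF.incl ω) where
  frobenius := isFrobenius (isFrobeniusClass_fgGorProj S)
  full := inferInstance
  faithful := inferInstance
  exact := isExact (isFrobeniusClass_fgProj S)
  conflation_iff := conflation_map_incl_iff
  extension_closed T hT h₁ h₃ := by
    rw [incl_essImage_iff] at h₁ h₃ ⊢
    exact ⟨(isFrobeniusClass_fgProj S).extension _ hT.1 h₁.1 h₃.1,
      (isFrobeniusClass_fgProj S).extension _ hT.2 h₁.2 h₃.2⟩
  exists_to_proj X := by
    obtain ⟨F₁, F₀, h₁, h₀, i, Z, p, w, h⟩ :=
      exists_inflation_contractible (isFrobeniusClass_fgProj S) X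
    -- The inclusion sends the contractible object over `𝒫` to the one over `𝒢` by definition, so
    -- projectivity can be quoted in the larger category.
    exact ⟨_, Z, i, p, w, h, isProj_contractible (isFrobeniusClass_fgGorProj S) h₁ h₀⟩
  exists_from_proj X := by
    obtain ⟨F₁, F₀, h₁, h₀, p, Z, i, w, h⟩ :=
      exists_deflation_contractible (isFrobeniusClass_fgProj S) X
    exact ⟨_, Z, i, p, w, h, isProj_contractible (isFrobeniusClass_fgGorProj S) h₁ h₀⟩

end Comparison

theorem corollary3p10 {S : Type u} [CommRing S] [IsLocalRing S] [IsNoetherianRing S] (ω : S)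
    (hω : ω ∈ IsLocalRing.maximalIdeal S) (hreg : ω ∈ nonZeroDivisors S) :
    -- `MF(ω, 𝒫)` is an admissible Frobenius subcategory of the Frobenius category `MF(ω, 𝒢)`
    ExactCat.IsAdmissibleSubcategory (MF.conflation (fgGorProj S) ω) (MF.conflation (fgProj S) ω)
      (MF.incl ω) ∧
    ∃ (_ : ExactCat.IsFrobenius (MF.conflation (fgGorProj S) ω))
      (_ : ExactCat.IsFrobenius (MF.conflation (fgProj S) ω)),
      -- the projective objects are the same
      (∀ X : MF (fgProj S) ω, ExactCat.IsProj (MF.conflation (fgProj S) ω) X ↔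
        ExactCat.IsProj (MF.conflation (fgGorProj S) ω) ((MF.incl ω).obj X)) ∧
      (∀ X : MF (fgGorProj S) ω, ExactCat.IsProj (MF.conflation (fgGorProj S) ω) X →
        hasTerms (fgProj S) ω X.obj) ∧
      -- the inclusion induces a fully faithful triangle functor of stable categories
      ∃ F : ExactCat.Stable (MF.conflation (fgProj S) ω) ⥤
          ExactCat.Stable (MF.conflation (fgGorProj S) ω),
        ExactCat.toStable (MF.conflation (fgProj S) ω) ⋙ F =
          MF.incl ω ⋙ ExactCat.toStable (MF.conflation (fgGorProj S) ω) ∧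
        F.Full ∧ F.Faithful ∧
        ExactCat.IsTriangleFunctor (MF.conflation (fgGorProj S) ω)
          (MF.conflation (fgProj S) ω) F := by
  have hG := isFrobeniusClass_fgGorProj S
  have frobG : ExactCat.IsFrobenius (MF.conflation (fgGorProj S) ω) := MF.isFrobenius hG
  have frobP : ExactCat.IsFrobenius (MF.conflation (fgProj S) ω) :=
    MF.isFrobenius (isFrobeniusClass_fgProj S)
  have hproj := fun X : MF (fgProj S) ω => (MF.isProj_incl_iff X).1
  refine ⟨MF.incl_isAdmissibleSubcategory ω, frobG, frobP, MF.isProj_incl_iff,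
    fun X => MF.hasTerms_fgProj_of_isProj hG,
    ExactCat.stableLift _ _ (MF.incl ω) hproj, CategoryTheory.Quotient.lift_spec _ _ _,
    ExactCat.stableLift_full _ _ _ hproj, ExactCat.stableLift_faithful _ _ _ hproj ?_,
    ExactCat.stableLift_isTriangleFunctor _ _ _ hproj
      fun T => (MF.conflation_map_incl_iff T).1⟩
  -- What remains is the input for faithfulness: each projective of `MF(ω, 𝒢)` is the image of a
  -- projective of `MF(ω, 𝒫)`.
  intro P hP
  have h := MF.hasTerms_fgProj_of_isProj hG hP
  exact ⟨⟨P.obj, h⟩, (MF.isProj_incl_iff ⟨P.obj, h⟩).2 hP, ⟨Iso.refl _⟩⟩
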